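/- Let $B\ge 2$, $m\ge 1$, let $\Omega_z\subset\mathbb{C}^B$ be a constellation of $2^m$ points (real constellations are included), and let $P$ be a real orthogonal $B\times B$ precoding matrix. Assume: if $B=2$, $\Omega_z$ is invariant under the rotation $(z_1,z_2)\mapsto(-z_2,z_1)$; if $B>2$, $\Omega_z$ is invariant under the cyclic shift of the components and $P$ is circulant. Put $\Omega_x=P\Omega_z$. For fading gains $\boldsymbol\alpha\in[0,\infty)^B$ and average SNR $\gamma>0$ consider the block fading channel $\mathbf Y=\boldsymbol\alpha\cdot\mathbf X+\mathbf W$ (componentwise product), where $\mathbf X$ is uniform on $\Omega_x$ and $\mathbf W$ is independent of $\mathbf X$ with i.i.d. $\mathcal{CN}(0,1/\gamma)$ components. Let $I(\boldsymbol\alpha,\gamma,P)=\frac1B I(\mathbf X;\mathbf Y)$ be the mutual information in bits per channel use, and for a rate $R$ let $V_{\mathrm o}=\{\boldsymbol\alpha\in[0,\infty)^B: I(\boldsymbol\alpha,\gamma,P)<R\}$ be the outage region. The instantaneous SNR at $\boldsymbol\alpha$ is $\gamma|\boldsymbol\alpha|^2$. Write $\alpha_{\mathrm o}\ge 0$ for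 the magnitude of an intersection of the outage boundary $I(\boldsymbol\alpha,\gamma,P)=R$ with a coordinate axis, and $\alpha_{\mathrm e}\ge 0$ for the common component of an intersection of the outage boundary with the ergodic line $\alpha_1=\dots=\alpha_B$. Then there is a threshold $\rho_0$, depending only on $\Omega_z$ and $P$, such that for all $\gamma>0$ and all $R$: (outer bound) if $\alpha_{\mathrm o}$ exists and $\gamma\alpha_{\mathrm o}^2\ge\rho_0$, then $V_{\mathrm o}\subseteq\{\boldsymbol\alpha\in[0,\infty)^B:\sum_b\alpha_b^2<\alpha_{\mathrm o}^2\}$; (inner bound) if $\alpha_{\mathrm e}$ exists and $\gamma B\alpha_{\mathrm e}^2\ge\rho_0$, then $\{\boldsymbol\alpha\in[0,\infty)^B:\sum_b\alpha_b^2<B\alpha_{\mathrm e}^2\}\subseteq V_{\mathrm o}$. Moreover, let $d_{\min}(\boldsymbol\alpha)$ be the minimum of $|\boldsymbol\alpha\cdot\mathbf x-\boldsymbol\alpha\cdot\mathbf x'|$ over distinct $\mathbf x,\mathbf x'\in\Omega_x$. For every $r\ge 0$, on the set of $\boldsymbol\alpha\in[0,\infty)^B$ with $\sum_b\alpha_b^2=r^2$,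 $d_{\min}$ attains its minimum at each of the points with one component equal to $r$ and the others $0$, and its maximum at the point with all components equal to $r/\sqrt B$. -/

import Mathlib

open MeasureTheory ProbabilityTheory

namespace BlockFading

/-- Mutual information `I(X;Y)`, in bits, of two random variables on `(S, μ)`: the Kullback-Leibler
divergence of their joint law from the product of their laws, divided by `log 2`. -/
noncomputable def mutualInfo {S 𝓧 𝓨 : Type*} [MeasurableSpace S] [MeasurableSpace 𝓧]
    [MeasurableSpace 𝓨] (μ : Measure S) (X : S → 𝓧) (Y : S → 𝓨) : ℝ :=
  (InformationTheory.klDiv (μ.map fun s => (X s, Y s)) ((μ.map X).prod (μ.map Y))).toReal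
    / Real.log 2

/-- The circularly symmetric law `𝒞𝒩(0, 2σ²)` on `ℂ` with `2σ² = 1/γ`: the real and the imaginary
part are independent centred Gaussians of variance `σ² = 1/(2γ)`. -/
noncomputable def complexNoise (γ : ℝ) : Measure ℂ :=
  ((gaussianReal 0 (1 / (2 * γ)).toNNReal).prod
    (gaussianReal 0 (1 / (2 * γ)).toNNReal)).map fun p => (⟨p.1, p.2⟩ : ℂ)

/-- The law of the noise vector, with `B` independent components. -/
noncomputable def noise (B : ℕ) (γ : ℝ) : Measure (Fin B → ℂ) :=
  Measure.pi fun _ => complexNoise γ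

/-- The real precoding matrix `P` acting on a complex vector, `x = P z`. -/
noncomputable def precode {B : ℕ} (P : Matrix (Fin B) (Fin B) ℝ) (z : Fin B → ℂ) : Fin B → ℂ :=
  fun i => ∑ j, (P i j : ℂ) * z j

/-- The precoded constellation `Ω_x = P Ω_z`. -/
noncomputable def precoded {B : ℕ} (P : Matrix (Fin B) (Fin B) ℝ) (Ωz : Finset (Fin B → ℂ)) :
    Finset (Fin B → ℂ) :=
  Ωz.image (precode P)

/-- The faded vector `t = α · x` (componentwise product). -/
noncomputable def fade {B : ℕ} (α : Fin B → ℝ) (x : Fin B → ℂ) : Fin B → ℂ :=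
  fun b => (α b : ℂ) * x b

/-- The instantaneous mutual information `I(α, γ, P) = (1/B) I(X; Y | α, γ)` in bits per channel
use: `X` is uniform on `Ω_x`, independent of the noise `W`, and `Y = α · X + W`. -/
noncomputable def instMutualInfo {B : ℕ} (Ωz : Finset (Fin B → ℂ)) (P : Matrix (Fin B) (Fin B) ℝ)
    (γ : ℝ) (α : Fin B → ℝ) : ℝ :=
  mutualInfo ((uniformOn (precoded P Ωz : Set (Fin B → ℂ))).prod (noise B γ))
    (fun p => p.1) (fun p => fade α p.1 + p.2) / B

/-- The outage region `V_o` in the fading space of nonnegative fading gains. -/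
def outageRegion {B : ℕ} (Ωz : Finset (Fin B → ℂ)) (P : Matrix (Fin B) (Fin B) ℝ) (γ R : ℝ) :
    Set (Fin B → ℝ) :=
  {α | (∀ b, 0 ≤ α b) ∧ instMutualInfo Ωz P γ α < R}

/-- The region of the fading space limited by the hypersphere `∑ α_b² = c`. -/
def sphereRegion (B : ℕ) (c : ℝ) : Set (Fin B → ℝ) :=
  {α | (∀ b, 0 ≤ α b) ∧ ∑ b, α b ^ 2 < c}

/-- The fading point on the axis `b` with magnitude `a`. -/
def axisPoint {B : ℕ} (b : Fin B) (a : ℝ) : Fin B → ℝ := Pi.single b a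

/-- The fading point on the ergodic line with all components equal to `a`. -/
def ergodicPoint (B : ℕ) (a : ℝ) : Fin B → ℝ := fun _ => a

/-- `a` is the magnitude `α_{b,o}` of an intersection of the outage boundary with the axis `b`. -/
def IsAxisMagnitude {B : ℕ} (Ωz : Finset (Fin B → ℂ)) (P : Matrix (Fin B) (Fin B) ℝ) (γ R : ℝ)
    (b : Fin B) (a : ℝ) : Prop :=
  0 ≤ a ∧ instMutualInfo Ωz P γ (axisPoint b a) = R

/-- `a` is the common component `α_e` of an intersection of the outage boundary with the ergodic
line. -/
def IsErgodicMagnitude {B : ℕ} (Ωz : Finset (Fin B → ℂ)) (P : Matrix (Fin B) (Fin B) ℝ) (γ R : ℝ)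
    (a : ℝ) : Prop :=
  0 ≤ a ∧ instMutualInfo Ωz P γ (ergodicPoint B a) = R

/-- The instantaneous signal-to-noise ratio `γ |α|²`. -/
def instSNR {B : ℕ} (γ : ℝ) (α : Fin B → ℝ) : ℝ := γ * ∑ b, α b ^ 2

/-- The minimum distance `d_min(α)` of the faded constellation `Ω_t`: the least Euclidean distance
between `α · x` and `α · x'` over distinct `x, x' ∈ Ω_x` (it is `0` if two faded points merge). -/
noncomputable def fadedMinDist {B : ℕ} (Ωz : Finset (Fin B → ℂ)) (P : Matrix (Fin B) (Fin B) ℝ)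
    (α : Fin B → ℝ) : ℝ :=
  sInf {d | ∃ x ∈ precoded P Ωz, ∃ x' ∈ precoded P Ωz, x ≠ x' ∧
    d = √(∑ b, ‖fade α x b - fade α x' b‖ ^ 2)}

/-- The symmetry conditions on the constellation and the precoder. For `B = 2`: `Ω_z` is invariant
under the rotation of 90 degrees and `P` is orthogonal. For `B > 2`: `Ω_z` is invariant under the
cyclic shift of the components and `P` is orthogonal and circulant. Never satisfied for `B < 2`. -/
def SymmetricPrecoding : (B : ℕ) → Finset (Fin B → ℂ) → Matrix (Fin B) (Fin B) ℝ → Prop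
  | 0, _, _ => False
  | 1, _, _ => False
  | 2, Ωz, P =>
      P ∈ Matrix.orthogonalGroup (Fin 2) ℝ ∧
      (fun z : Fin 2 → ℂ => ![-z 1, z 0]) '' (Ωz : Set (Fin 2 → ℂ)) = (Ωz : Set (Fin 2 → ℂ))
  | n + 3, Ωz, P =>
      P ∈ Matrix.orthogonalGroup (Fin (n + 3)) ℝ ∧
      (∃ v : Fin (n + 3) → ℝ, P = Matrix.circulant v) ∧
      (fun (z : Fin (n + 3) → ℂ) (i : Fin (n + 3)) => z (i + 1)) '' (Ωz : Set (Fin (n + 3) → ℂ))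
        = (Ωz : Set (Fin (n + 3) → ℂ))

end BlockFading

/-!
The threshold `ρ₀ = 0` works: all claims follow from the fact that the mutual information, as a
function of the vector `a = (2 γ α_b²)_b` of squared gains, is concave, is invariant under cyclic
shifts of `a`, and increases along rays from the origin.

Concavity and shift invariance give the comparison on a simplex `∑ a_b = S`, by Jensen's inequality:
the value at the vertices is minimal, since every point is a convex combination of vertices
(`vertex_le_of_concaveOn`), and the value at the barycentre is maximal, since the barycentre is the
mean of the shifts of any point (`le_barycentre_of_concaveOn`). A vertex is a point on an axis, and
the barycentre lies on the ergodic line. Monotonicity along the axes then gives the outer bound, and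
strict monotonicity along the ergodic line the inner bound. The squared gains also determine the
minimum distance, which is an infimum of square roots of linear functions and hence concave; the
same two lemmas therefore prove the statement about `d_min`.

The analytic core is the concavity (`concaveOn_info`). In real coordinates the channel has the
likelihoods `ℓ_k = exp(∑_j (σ_j x_{kj} z_j - (σ_j x_{kj})² / 2))` relative to pure noise `z`, and
with `g = ∑_k ℓ_k` the mutual information is, up to constants, `∑_k E[ℓ_k log ℓ_k] - E[g log g]`
(`mutualInfo_uniformOn`, `instMutualInfo_eq`). Differentiation along a path of gains and Gaussian
integration by parts (`BoundedPath.hasDerivAt_integral`) show that the derivative with respect to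
`σ_j²` is half the mean square error in coordinate `j` (`BoundedPath.hasDerivAt_info`), so that the
mutual information increases, and that the second derivative in a direction `v` is
`-(1/2) E[g ∑_{i,j} v_i v_j C_{ij}²]`, where `C` is the posterior covariance matrix of `x`
(`BoundedPath.hasDerivAt_mmse`). The entrywise square of a covariance matrix is positive
semidefinite (`sum_mul_wcov_sq_nonneg`), hence the second derivative is nonpositive.
-/

namespace BlockFading

/-! ### Gaussian integration by parts and translation -/

section Gaussian

variable {ι : Type*} [Fintype ι]

/-- A finite product of measures with densities has the product of the densities as its density. -/
lemma pi_withDensity {μ : ι → Measure ℝ} [∀ i, SigmaFinite (μ i)] {f : ι → ℝ → ℝ}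
    (hf : ∀ i, Integrable (f i) (μ i)) (hpos : ∀ i y, 0 ≤ f i y) :
    Measure.pi (fun i => (μ i).withDensity fun y => ENNReal.ofReal (f i y)) =
      (Measure.pi μ).withDensity fun z => ENNReal.ofReal (∏ i, f i (z i)) := by
  have hfin : ∀ i, IsFiniteMeasure ((μ i).withDensity fun y => ENNReal.ofReal (f i y)) := fun i =>
    isFiniteMeasure_withDensity_ofReal (hf i).2
  refine (Measure.pi_eq fun s hs => ?_)
  have key : ∀ i, ((μ i).withDensity fun y => ENNReal.ofReal (f i y)) (s i) =
      ENNReal.ofReal (∫ y in s i, f i y ∂μ i) := fun i => by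
    rw [withDensity_apply _ (hs i), ofReal_integral_eq_lintegral_ofReal (hf i).restrict
      (ae_of_all _ (hpos i))]
  simp_rw [key]
  rw [withDensity_apply _ (MeasurableSet.univ_pi hs), Measure.restrict_pi_pi,
    ← ofReal_integral_eq_lintegral_ofReal (.fintype_prod fun i => (hf i).restrict)
      (ae_of_all _ fun z => Finset.prod_nonneg fun i _ => hpos i _),
    integral_fintype_prod_eq_prod, ENNReal.ofReal_prod_of_nonneg]
  exact fun i _ => integral_nonneg (hpos i)

/-- The standard Gaussian measure on `ι → ℝ`. -/
noncomputable def stdGauss (ι : Type*) [Fintype ι] : Measure (ι → ℝ) :=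
  Measure.pi fun _ => gaussianReal 0 1

instance : IsProbabilityMeasure (stdGauss ι) := by unfold stdGauss; infer_instance

/-- The Lebesgue density of `stdGauss`, as the product of the one-dimensional densities. -/
noncomputable def stdGaussPDF (z : ι → ℝ) : ℝ := ∏ i, gaussianPDFReal 0 1 (z i)

lemma stdGauss_eq_withDensity :
    stdGauss ι = volume.withDensity fun z => ENNReal.ofReal (stdGaussPDF z) := by
  have := pi_withDensity (μ := fun _ : ι => volume) (f := fun _ => gaussianPDFReal 0 1)
    (fun _ => integrable_gaussianPDFReal 0 1) (fun _ => gaussianPDFReal_nonneg 0 1)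
  rw [stdGauss, gaussianReal_of_var_ne_zero _ one_ne_zero]
  exact this

lemma stdGaussPDF_eq (z : ι → ℝ) :
    stdGaussPDF z = (∏ _i : ι, (√(2 * Real.pi))⁻¹) * Real.exp (-∑ i, z i ^ 2 / 2) := by
  simp only [stdGaussPDF, gaussianPDFReal, Finset.prod_mul_distrib, ← Real.exp_sum,
    ← Finset.sum_neg_distrib]
  simp [neg_div]

lemma stdGaussPDF_nonneg (z : ι → ℝ) : 0 ≤ stdGaussPDF z :=
  Finset.prod_nonneg fun _ _ => gaussianPDFReal_nonneg _ _ _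

lemma measurable_stdGaussPDF : Measurable (stdGaussPDF : (ι → ℝ) → ℝ) := by
  unfold stdGaussPDF
  exact Finset.measurable_prod _ fun i _ =>
    (measurable_gaussianPDFReal 0 1).comp (measurable_pi_apply i)

lemma integral_stdGauss (k : (ι → ℝ) → ℝ) :
    ∫ z, k z ∂stdGauss ι = ∫ z, k z * stdGaussPDF z := by
  rw [stdGauss_eq_withDensity, integral_withDensity_eq_integral_toReal_smul
    measurable_stdGaussPDF.ennreal_ofReal (ae_of_all _ fun _ => ENNReal.ofReal_lt_top)]
  simp [ENNReal.toReal_ofReal (stdGaussPDF_nonneg _), mul_comm]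

lemma integrable_stdGauss_iff {k : (ι → ℝ) → ℝ} :
    Integrable k (stdGauss ι) ↔ Integrable fun z => k z * stdGaussPDF z := by
  rw [stdGauss_eq_withDensity, integrable_withDensity_iff measurable_stdGaussPDF.ennreal_ofReal
    (ae_of_all _ fun _ => ENNReal.ofReal_lt_top)]
  simp [ENNReal.toReal_ofReal (stdGaussPDF_nonneg _)]

/-- Gaussian integration by parts (Stein's identity) in the coordinate `j`. -/
lemma integral_coord_mul_stdGauss [DecidableEq ι] (j : ι) {k k' : (ι → ℝ) → ℝ}
    (hk : ∀ z, HasLineDerivAt ℝ k (k' z) z (Pi.single j 1))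
    (hi : Integrable k (stdGauss ι)) (hi' : Integrable k' (stdGauss ι))
    (hij : Integrable (fun z => z j * k z) (stdGauss ι)) :
    ∫ z, z j * k z ∂stdGauss ι = ∫ z, k' z ∂stdGauss ι := by
  have hw : ∀ z : ι → ℝ, HasLineDerivAt ℝ stdGaussPDF (-(z j) * stdGaussPDF z) z
      (Pi.single j 1) := by
    intro z
    simp only [HasLineDerivAt, stdGaussPDF_eq]
    -- the logarithmic derivative of the Gaussian density in direction `j` is `-z j`
    have h1 : HasDerivAt (fun t : ℝ => -∑ i, (z + t • (Pi.single j (1 : ℝ) : ι → ℝ)) i ^ 2 / 2)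
        (-∑ i, (z i * (Pi.single j (1 : ℝ) : ι → ℝ) i)) 0 := by
      refine (HasDerivAt.fun_sum fun i _ => ?_).fun_neg
      have := ((((hasDerivAt_id (0 : ℝ)).mul_const
        ((Pi.single j (1 : ℝ) : ι → ℝ) i)).const_add (z i)).pow 2).div_const 2
      exact this.congr_deriv (by simp; ring)
    have h2 := h1.exp.const_mul (∏ _i : ι, (√(2 * Real.pi))⁻¹)
    exact h2.congr_deriv (by simp [Pi.single_apply]; ring)
  have hp := integral_bilinear_hasLineDerivAt_right_eq_neg_left_of_integrable
    (μ := (volume : Measure (ι → ℝ))) (f := k) (f' := k') (g := stdGaussPDF)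
    (g' := fun z => -(z j) * stdGaussPDF z) (v := Pi.single j 1)
    (B := ContinuousLinearMap.mul ℝ ℝ) (by simpa using integrable_stdGauss_iff.1 hi')
    (by
      convert (integrable_stdGauss_iff.1 hij).neg using 2 with z
      simp; ring) (by simpa using integrable_stdGauss_iff.1 hi)
    (fun z _ => hk z) (fun z _ => hw z)
  simp only [ContinuousLinearMap.mul_apply'] at hp
  rw [integral_stdGauss, integral_stdGauss, ← neg_neg (∫ z, k' z * stdGaussPDF z), ← hp,
    ← integral_neg]
  congr with z
  ring

/-- The Cameron-Martin formula for the standard Gaussian measure. -/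
lemma stdGauss_map_add (a : ι → ℝ) :
    (stdGauss ι).map (fun z => a + z) = (stdGauss ι).withDensity fun z =>
      ENNReal.ofReal (Real.exp (∑ j, (a j * z j - a j ^ 2 / 2))) := by
  have h1 : (stdGauss ι).map (fun z => a + z) =
      Measure.pi fun j => gaussianReal (a j) 1 := by
    have := Measure.pi_map_pi (μ := fun _ : ι => gaussianReal 0 1) (f := fun j y => a j + y)
      (hμ := fun j => by rw [gaussianReal_map_const_add]; infer_instance)
      (fun j => by fun_prop)
    simp only [gaussianReal_map_const_add, zero_add] at this
    exact this
  have h2 : ∀ j, gaussianReal (a j) 1 = (gaussianReal 0 1).withDensity fun y =>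
      ENNReal.ofReal (Real.exp (a j * y - a j ^ 2 / 2)) := fun j => by
    rw [gaussianReal_of_var_ne_zero _ one_ne_zero, gaussianReal_of_var_ne_zero _ one_ne_zero,
      ← withDensity_mul _ (measurable_gaussianPDF 0 1) (by fun_prop)]
    congr 1 with y
    simp only [gaussianPDF, Pi.mul_apply, gaussianPDFReal]
    rw [← ENNReal.ofReal_mul (by positivity),
      mul_assoc (√(2 * Real.pi * ((1 : NNReal) : ℝ)))⁻¹, ← Real.exp_add]
    congr 3
    simp
    ring
  rw [h1]
  simp_rw [h2, Real.exp_sum]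
  refine pi_withDensity (f := fun j y => Real.exp (a j * y - a j ^ 2 / 2)) (fun j => ?_)
    fun j y => (Real.exp_pos _).le
  simp_rw [sub_eq_add_neg, Real.exp_add]
  exact (integrable_exp_mul_gaussianReal (a j)).mul_const _

lemma integrable_exp_sum_abs (C : ℝ) :
    Integrable (fun z : ι → ℝ => Real.exp (C * (1 + ∑ j, |z j|))) (stdGauss ι) := by
  have : (fun z : ι → ℝ => Real.exp (C * (1 + ∑ j, |z j|))) =
      fun z => Real.exp C * ∏ j, Real.exp (C * |z j|) := by
    ext z
    rw [← Real.exp_sum, ← Real.exp_add, mul_add, mul_one, Finset.mul_sum]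
  rw [this]
  refine Integrable.const_mul (Integrable.fintype_prod (f := fun _ y => Real.exp (C * |y|))
    fun j => ?_) _
  refine ((integrable_exp_mul_gaussianReal C).add (integrable_exp_mul_gaussianReal (-C))).mono'
    (by fun_prop) (ae_of_all _ fun y => ?_)
  rw [Real.norm_of_nonneg (Real.exp_pos _).le]
  rcases abs_cases y with h | h
  · simp [h.1, (Real.exp_pos _).le]
  · simp [h.1, (Real.exp_pos _).le]

end Gaussian

/-! ### Families of exponential growth and paths of gains -/

section Growth

variable {ι : Type*} [Fintype ι]

/-- A family of functions `h t` on `ι → ℝ` that are measurable and grow at most exponentially,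
uniformly for `t ∈ s`. Such families are dominated by one function that is integrable with respect
to the standard Gaussian measure. -/
def ExpGrowth (s : Set ℝ) (h : ℝ → (ι → ℝ) → ℝ) : Prop :=
  (∀ t ∈ s, Measurable (h t)) ∧
    ∃ C, 0 ≤ C ∧ ∀ t ∈ s, ∀ z, |h t z| ≤ Real.exp (C * (1 + ∑ j, |z j|))

lemma one_le_one_add_sum_abs (z : ι → ℝ) : 1 ≤ 1 + ∑ j, |z j| :=
  le_add_of_nonneg_right (Finset.sum_nonneg fun _ _ => abs_nonneg _)

variable {s : Set ℝ} {h h' : ℝ → (ι → ℝ) → ℝ}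

lemma ExpGrowth.add (hh : ExpGrowth s h) (hh' : ExpGrowth s h') :
    ExpGrowth s fun t z => h t z + h' t z := by
  obtain ⟨hm, C, hC, hb⟩ := hh
  obtain ⟨hm', C', hC', hb'⟩ := hh'
  refine ⟨fun t ht => (hm t ht).add (hm' t ht), max C C' + 1, by positivity, fun t ht z => ?_⟩
  have h1 := one_le_one_add_sum_abs z
  have e1 : Real.exp (C * (1 + ∑ j, |z j|)) ≤ Real.exp (max C C' * (1 + ∑ j, |z j|)) := by
    gcongr; exact le_max_left _ _
  have e2 : Real.exp (C' * (1 + ∑ j, |z j|)) ≤ Real.exp (max C C' * (1 + ∑ j, |z j|)) := by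
    gcongr; exact le_max_right _ _
  have e3 : 2 ≤ Real.exp (1 + ∑ j, |z j|) := by linarith [Real.add_one_le_exp (1 + ∑ j, |z j|)]
  -- the factor `2` of the sum of two exponentials is absorbed by raising the rate by one
  rw [add_mul, one_mul, Real.exp_add]
  have := Real.exp_pos (max C C' * (1 + ∑ j, |z j|))
  nlinarith [abs_add_le (h t z) (h' t z), hb t ht z, hb' t ht z]

lemma ExpGrowth.mul (hh : ExpGrowth s h) (hh' : ExpGrowth s h') :
    ExpGrowth s fun t z => h t z * h' t z := by
  obtain ⟨hm, C, hC, hb⟩ := hh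
  obtain ⟨hm', C', hC', hb'⟩ := hh'
  refine ⟨fun t ht => (hm t ht).mul (hm' t ht), C + C', by positivity, fun t ht z => ?_⟩
  rw [abs_mul, add_mul, Real.exp_add]
  exact mul_le_mul (hb t ht z) (hb' t ht z) (abs_nonneg _) (Real.exp_pos _).le

lemma ExpGrowth.of_bounded (hm : ∀ t ∈ s, Measurable (h t)) {C : ℝ}
    (hC : ∀ t ∈ s, ∀ z, |h t z| ≤ C) : ExpGrowth s h := by
  refine ⟨hm, |C|, abs_nonneg _, fun t ht z => (hC t ht z).trans ?_⟩
  have h1 := one_le_one_add_sum_abs z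
  have h2 := abs_nonneg C
  have h3 := Real.add_one_le_exp (|C| * (1 + ∑ j, |z j|))
  nlinarith [le_abs_self C]

lemma ExpGrowth.const (c : ℝ) : ExpGrowth s fun _ (_ : ι → ℝ) => c :=
  .of_bounded (fun _ _ => measurable_const) fun _ _ _ => le_rfl

lemma ExpGrowth.sub (hh : ExpGrowth s h) (hh' : ExpGrowth s h') :
    ExpGrowth s fun t z => h t z - h' t z := by
  simpa [sub_eq_add_neg] using hh.add ((ExpGrowth.const (-1)).mul hh')

lemma ExpGrowth.sum {κ : Type*} (F : Finset κ) {h : κ → ℝ → (ι → ℝ) → ℝ}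
    (hh : ∀ k, ExpGrowth s (h k)) : ExpGrowth s fun t z => ∑ k ∈ F, h k t z := by
  classical
  induction F using Finset.induction_on with
  | empty => simpa using ExpGrowth.const 0
  | insert k F hk ih => simpa [Finset.sum_insert hk] using (hh k).add ih

lemma ExpGrowth.coord (j : ι) : ExpGrowth s fun _ (z : ι → ℝ) => z j := by
  refine ⟨fun _ _ => measurable_pi_apply j, 1, zero_le_one, fun t _ z => ?_⟩
  have h1 : |z j| ≤ ∑ j, |z j| :=
    Finset.single_le_sum (f := fun j => |z j|) (fun _ _ => abs_nonneg _) (Finset.mem_univ j)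
  linarith [Real.add_one_le_exp (1 * (1 + ∑ j, |z j|))]

lemma ExpGrowth.integrable (hh : ExpGrowth s h) {t : ℝ} (ht : t ∈ s) :
    Integrable (h t) (stdGauss ι) := by
  obtain ⟨hm, C, -, hb⟩ := hh
  exact (integrable_exp_sum_abs C).mono' (hm t ht).aestronglyMeasurable (ae_of_all _ (hb t ht))

lemma ExpGrowth.continuousOn_integral (hh : ExpGrowth s h)
    (hc : ∀ z, ContinuousOn (fun t => h t z) s) :
    ContinuousOn (fun t => ∫ z, h t z ∂stdGauss ι) s := by
  obtain ⟨hm, C, -, hb⟩ := hh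
  exact continuousOn_of_dominated (fun t ht => (hm t ht).aestronglyMeasurable)
    (fun t ht => ae_of_all _ (hb t ht)) (integrable_exp_sum_abs C) (ae_of_all _ hc)

lemma ExpGrowth.hasDerivAt_integral {t₀ : ℝ} (hs : s ∈ nhds t₀) (hh : ExpGrowth s h)
    (hh' : ExpGrowth s h') (hd : ∀ t ∈ s, ∀ z, HasDerivAt (fun t => h t z) (h' t z) t) :
    HasDerivAt (fun t => ∫ z, h t z ∂stdGauss ι) (∫ z, h' t₀ z ∂stdGauss ι) t₀ := by
  have ht₀ := mem_of_mem_nhds hs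
  obtain ⟨hm, C, -, hb⟩ := hh'
  exact (hasDerivAt_integral_of_dominated_loc_of_deriv_le hs
    (Filter.eventually_of_mem hs fun t ht => (hh.1 t ht).aestronglyMeasurable) (hh.integrable ht₀)
    (hm t₀ ht₀).aestronglyMeasurable (ae_of_all _ fun z t ht => hb t ht z)
    (integrable_exp_sum_abs C) (ae_of_all _ fun z t ht => hd t ht z)).2

/-- A curve `σ` in `ι → ℝ` which, on the set `s` of times, is bounded and has a bounded
derivative `ρ`. -/
structure BoundedPath (s : Set ℝ) (σ ρ : ℝ → ι → ℝ) : Prop where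
  hasDerivAt : ∀ t ∈ s, ∀ j, HasDerivAt (fun t => σ t j) (ρ t j) t
  bdd : ∃ R, ∀ t ∈ s, ∀ j, |σ t j| ≤ R
  bdd_deriv : ∃ R, ∀ t ∈ s, ∀ j, |ρ t j| ≤ R

/-- Differentiation of a Gaussian expectation along a path of scales. If the derivative of `h` is
`∑ⱼ ρⱼ (zⱼ aⱼ - σⱼ bⱼ)`, then integration by parts turns `zⱼ aⱼ` into `∂aⱼ/∂zⱼ`, and only the
excess `σⱼ cⱼ` of that derivative over `σⱼ bⱼ` is left. -/
lemma BoundedPath.hasDerivAt_integral [DecidableEq ι] {σ ρ : ℝ → ι → ℝ} {t₀ : ℝ}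
    (hp : BoundedPath s σ ρ) (hs : s ∈ nhds t₀) {a b c : ι → ℝ → (ι → ℝ) → ℝ}
    (hh : ExpGrowth s h) (ha : ∀ j, ExpGrowth s (a j)) (hb : ∀ j, ExpGrowth s (b j))
    (hc : ∀ j, ExpGrowth s (c j))
    (hd : ∀ t ∈ s, ∀ z, HasDerivAt (fun t => h t z)
      (∑ j, ρ t j * (z j * a j t z - σ t j * b j t z)) t)
    (hl : ∀ j z, HasLineDerivAt ℝ (a j t₀) (σ t₀ j * (b j t₀ z + c j t₀ z)) z (Pi.single j 1)) :
    HasDerivAt (fun t => ∫ z, h t z ∂stdGauss ι)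
      (∑ j, ρ t₀ j * σ t₀ j * ∫ z, c j t₀ z ∂stdGauss ι) t₀ := by
  have ht₀ := mem_of_mem_nhds hs
  obtain ⟨R, hR⟩ := hp.bdd
  obtain ⟨R', hR'⟩ := hp.bdd_deriv
  have hσ : ∀ j, ExpGrowth s fun t (_ : ι → ℝ) => σ t j := fun j =>
    .of_bounded (fun _ _ => measurable_const) fun t ht _ => hR t ht j
  have hρ : ∀ j, ExpGrowth s fun t (_ : ι → ℝ) => ρ t j := fun j =>
    .of_bounded (fun _ _ => measurable_const) fun t ht _ => hR' t ht j
  have hza : ∀ j, ExpGrowth s fun t z => z j * a j t z := fun j =>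
    (ExpGrowth.coord j).mul (ha j)
  have hsb : ∀ j, ExpGrowth s fun t z => σ t j * b j t z := fun j => (hσ j).mul (hb j)
  have hmain := hh.hasDerivAt_integral hs
    (ExpGrowth.sum Finset.univ fun j => (hρ j).mul ((hza j).sub (hsb j))) hd
  refine hmain.congr_deriv ?_
  rw [integral_finsetSum _ fun j _ => ((hρ j).mul ((hza j).sub (hsb j))).integrable ht₀]
  refine Finset.sum_congr rfl fun j _ => ?_
  rw [integral_const_mul, integral_sub ((hza j).integrable ht₀) ((hsb j).integrable ht₀),
    integral_coord_mul_stdGauss j (hl j) ((ha j).integrable ht₀)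
      (((hσ j).mul ((hb j).add (hc j))).integrable ht₀) ((hza j).integrable ht₀),
    integral_const_mul, integral_const_mul,
    integral_add ((hb j).integrable ht₀) ((hc j).integrable ht₀)]
  ring

end Growth

/-! ### Weighted means and covariances -/

section Weights

variable {κ : Type*} [Fintype κ]

/-- The mean of `f` for the weights `w`, which need not be normalized. -/
noncomputable def wmean (w f : κ → ℝ) : ℝ := (∑ k, w k * f k) / ∑ k, w k

/-- The covariance of `f` and `f'` for the weights `w`, which need not be normalized. -/
noncomputable def wcov (w f f' : κ → ℝ) : ℝ :=
  wmean w (fun k => f k * f' k) - wmean w f * wmean w f'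

lemma sum_mul_wmean {w : κ → ℝ} (hw : 0 < ∑ k, w k) (f : κ → ℝ) :
    (∑ k, w k) * wmean w f = ∑ k, w k * f k := by
  unfold wmean; field_simp

lemma abs_wmean_le {w : κ → ℝ} (hw : ∀ k, 0 < w k) (f : κ → ℝ) :
    |wmean w f| ≤ ∑ k, |f k| := by
  rcases isEmpty_or_nonempty κ with he | he
  · simp [wmean]
  have hpos : 0 < ∑ k, w k := Finset.sum_pos (fun k _ => hw k) Finset.univ_nonempty
  rw [wmean, abs_div, abs_of_pos hpos, div_le_iff₀ hpos, Finset.sum_mul_sum]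
  refine (Finset.abs_sum_le_sum_abs _ _).trans (Finset.sum_le_sum fun k _ => ?_)
  rw [abs_mul, abs_of_pos (hw k), mul_comm, ← Finset.mul_sum]
  gcongr
  exact Finset.single_le_sum (f := w) (fun k _ => (hw k).le) (Finset.mem_univ k)

lemma wcov_eq {w : κ → ℝ} (hw : 0 < ∑ k, w k) (f f' : κ → ℝ) :
    wcov w f f' = wmean w fun k => (f k - wmean w f) * (f' k - wmean w f') := by
  have h1 : ∑ k, w k * ((f k - wmean w f) * (f' k - wmean w f')) =
      (∑ k, w k * (f k * f' k)) - wmean w f' * (∑ k, w k * f k) -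
        wmean w f * (∑ k, w k * f' k) + wmean w f * wmean w f' * ∑ k, w k := by
    simp only [Finset.mul_sum, ← Finset.sum_sub_distrib, ← Finset.sum_add_distrib]
    exact Finset.sum_congr rfl fun k _ => by ring
  rw [wcov]
  conv_rhs => rw [wmean, h1]
  rw [← sum_mul_wmean hw f, ← sum_mul_wmean hw f', ← sum_mul_wmean hw fun k => f k * f' k]
  field_simp
  ring

lemma sum_mul_wcov {w : κ → ℝ} (hw : 0 < ∑ k, w k) (f f' : κ → ℝ) :
    (∑ k, w k) * wcov w f f' = (∑ k, w k * (f k * f' k)) - wmean w f * ∑ k, w k * f' k := by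
  rw [← sum_mul_wmean hw f', ← sum_mul_wmean hw fun k => f k * f' k, wcov]
  ring

lemma wcov_const_mul (w f f' : κ → ℝ) (c : ℝ) :
    wcov w f (fun k => c * f' k) = c * wcov w f f' := by
  have h : ∀ h : κ → ℝ, ∑ k, w k * (c * h k) = c * ∑ k, w k * h k := fun h => by
    rw [Finset.mul_sum]; exact Finset.sum_congr rfl fun k _ => by ring
  simp only [wcov, wmean, mul_left_comm (f _) c, h]
  ring

lemma wcov_self_nonneg {w : κ → ℝ} (hw : ∀ k, 0 ≤ w k) (hpos : 0 < ∑ k, w k) (f : κ → ℝ) :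
    0 ≤ wcov w f f := by
  rw [wcov_eq hpos]
  exact div_nonneg (Finset.sum_nonneg fun k _ => mul_nonneg (hw k) (mul_self_nonneg _)) hpos.le

lemma wcov_self_pos {w : κ → ℝ} (hw : ∀ k, 0 < w k) {f : κ → ℝ} {k l : κ} (hkl : f k ≠ f l) :
    0 < wcov w f f := by
  have hpos : 0 < ∑ k, w k := Finset.sum_pos (fun k _ => hw k) ⟨k, Finset.mem_univ k⟩
  rw [wcov_eq hpos]
  refine div_pos ?_ hpos
  refine lt_of_le_of_ne (Finset.sum_nonneg fun k _ => mul_nonneg (hw k).le (mul_self_nonneg _))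
    fun h0 => hkl ?_
  have hz := (Finset.sum_eq_zero_iff_of_nonneg fun k _ =>
    mul_nonneg (hw k).le (mul_self_nonneg _)).1 h0.symm
  have hzero : ∀ k, f k = wmean w f := fun k => by
    have := hz k (Finset.mem_univ k)
    rcases mul_eq_zero.1 this with h | h
    · exact absurd h (hw k).ne'
    · exact sub_eq_zero.1 (mul_self_eq_zero.1 h)
  rw [hzero k, hzero l]

/-- The Schur product theorem for the covariance matrix `C` of a random vector `f`: the entrywise
square of `C` is positive semidefinite, since its quadratic form is the mean, over two independent
copies, of a squared weighted correlation. -/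
lemma sum_mul_wcov_sq_nonneg {ι : Type*} [Fintype ι] {w : κ → ℝ} (hw : ∀ k, 0 ≤ w k)
    (hpos : 0 < ∑ k, w k) (f : ι → κ → ℝ) (v : ι → ℝ) :
    0 ≤ ∑ j, ∑ i, v j * v i * wcov w (f j) (f i) ^ 2 := by
  -- with the centred values `y`, the quadratic form is a double sum of squares over `k` and `l`
  set y : ι → κ → ℝ := fun j k => f j k - wmean w (f j) with hy
  have h1 : ∀ j i, wcov w (f j) (f i) = (∑ k, w k * (y j k * y i k)) / ∑ k, w k := fun j i => by
    rw [wcov_eq hpos, wmean]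
  have h2 : ∑ j, ∑ i, v j * v i * wcov w (f j) (f i) ^ 2 =
      (∑ k, ∑ l, w k * w l * (∑ j, v j * (y j k * y j l)) ^ 2) / (∑ k, w k) ^ 2 := by
    simp_rw [h1, div_pow, ← mul_div_assoc, ← Finset.sum_div, sq, Finset.sum_mul_sum,
      Finset.mul_sum]
    congr 1
    calc _ = ∑ j, ∑ k, ∑ i, ∑ l, v j * v i * (w k * (y j k * y i k) * (w l * (y j l * y i l))) :=
          Finset.sum_congr rfl fun j _ => Finset.sum_comm
      _ = ∑ k, ∑ j, ∑ i, ∑ l, v j * v i * (w k * (y j k * y i k) * (w l * (y j l * y i l))) :=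
          Finset.sum_comm
      _ = ∑ k, ∑ j, ∑ l, ∑ i, v j * v i * (w k * (y j k * y i k) * (w l * (y j l * y i l))) :=
          Finset.sum_congr rfl fun k _ => Finset.sum_congr rfl fun j _ => Finset.sum_comm
      _ = ∑ k, ∑ l, ∑ j, ∑ i, v j * v i * (w k * (y j k * y i k) * (w l * (y j l * y i l))) :=
          Finset.sum_congr rfl fun k _ => Finset.sum_comm
      _ = _ := by
          refine Finset.sum_congr rfl fun k _ => Finset.sum_congr rfl fun l _ =>
            Finset.sum_congr rfl fun j _ => Finset.sum_congr rfl fun i _ => ?_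
          ring
  rw [h2]
  exact div_nonneg (Finset.sum_nonneg fun k _ => Finset.sum_nonneg fun l _ =>
    mul_nonneg (mul_nonneg (hw k) (hw l)) (sq_nonneg _)) (sq_nonneg _)

/-- Exponential weights: if the logarithmic derivatives of the weights are `θ`, then the unnormalized
moment of `f` has as derivative the unnormalized moment of `f θ`. -/
lemma hasDerivAt_sum_mul {w : ℝ → κ → ℝ} {θ : κ → ℝ} {t₀ : ℝ}
    (hw : ∀ k, HasDerivAt (fun t => w t k) (w t₀ k * θ k) t₀) (f : κ → ℝ) :
    HasDerivAt (fun t => ∑ k, w t k * f k) (∑ k, w t₀ k * (f k * θ k)) t₀ := by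
  refine (HasDerivAt.fun_sum fun k _ => (hw k).mul_const (f k)).congr_deriv ?_
  exact Finset.sum_congr rfl fun k _ => by ring

lemma hasDerivAt_sum_weights {w : ℝ → κ → ℝ} {θ : κ → ℝ} {t₀ : ℝ}
    (hw : ∀ k, HasDerivAt (fun t => w t k) (w t₀ k * θ k) t₀) :
    HasDerivAt (fun t => ∑ k, w t k) (∑ k, w t₀ k * θ k) t₀ :=
  HasDerivAt.fun_sum fun k _ => hw k

/-- For exponential weights, the derivative of a mean is a covariance with the score `θ`. -/
lemma hasDerivAt_wmean {w : ℝ → κ → ℝ} {θ : κ → ℝ} {t₀ : ℝ}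
    (hw : ∀ k, HasDerivAt (fun t => w t k) (w t₀ k * θ k) t₀) (hpos : 0 < ∑ k, w t₀ k)
    (f : κ → ℝ) :
    HasDerivAt (fun t => wmean (w t) f) (wcov (w t₀) f θ) t₀ := by
  refine ((hasDerivAt_sum_mul hw f).fun_div (hasDerivAt_sum_weights hw) hpos.ne').congr_deriv ?_
  unfold wcov wmean
  field_simp

end Weights

/-! ### Likelihoods and the derivatives of their entropy -/

section Likelihood

variable {ι κ : Type*} [Fintype ι]

/-- The likelihood, relative to pure noise, of the point `x k` when `z` is observed at the output of
parallel Gaussian channels with noise of variance one and gains `σ`. -/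
noncomputable def lik (x : κ → ι → ℝ) (σ z : ι → ℝ) (k : κ) : ℝ :=
  Real.exp (∑ j, (σ j * x k j * z j - (σ j * x k j) ^ 2 / 2))

lemma lik_pos (x : κ → ι → ℝ) (σ z : ι → ℝ) (k : κ) : 0 < lik x σ z k := Real.exp_pos _

lemma lik_unit (x : κ → ι → ℝ) (σ z : ι → ℝ) (k : κ) :
    lik (fun _ : Unit => x k) σ z () = lik x σ z k := rfl

lemma measurable_lik (x : κ → ι → ℝ) (σ : ι → ℝ) (k : κ) :
    Measurable fun z => lik x σ z k := by
  unfold lik; fun_prop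

lemma hasDerivAt_lik_line [DecidableEq ι] (x : κ → ι → ℝ) (σ z : ι → ℝ) (k : κ) (i : ι) :
    HasDerivAt (fun t : ℝ => lik x σ (z + t • Pi.single i 1) k)
      (lik x σ (z + (0 : ℝ) • Pi.single i 1) k * (σ i * x k i)) 0 := by
  unfold lik
  have h1 : HasDerivAt (fun t : ℝ => ∑ j, (σ j * x k j *
        (z + t • (Pi.single i (1 : ℝ) : ι → ℝ)) j - (σ j * x k j) ^ 2 / 2))
      (∑ j, σ j * x k j * (Pi.single i (1 : ℝ) : ι → ℝ) j) 0 := by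
    refine HasDerivAt.fun_sum fun j _ => ?_
    have := ((((hasDerivAt_id (0 : ℝ)).mul_const
        ((Pi.single i (1 : ℝ) : ι → ℝ) j)).const_add (z j)).const_mul (σ j * x k j)).sub_const
          ((σ j * x k j) ^ 2 / 2)
    exact this.congr_deriv (by simp)
  exact h1.exp.congr_deriv (by simp [Pi.single_apply])

variable {s : Set ℝ} {σ ρ : ℝ → ι → ℝ}

/-- The logarithmic derivative of the likelihood of `x k` along a path through the gains `σ` with
velocity `ρ`. -/
noncomputable def score (x : κ → ι → ℝ) (σ ρ z : ι → ℝ) (k : κ) : ℝ :=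
  ∑ j, ρ j * (z j * x k j - σ j * x k j ^ 2)

lemma BoundedPath.hasDerivAt_lik (hp : BoundedPath s σ ρ) (x : κ → ι → ℝ) (z : ι → ℝ) (k : κ)
    {t : ℝ} (ht : t ∈ s) :
    HasDerivAt (fun t => lik x (σ t) z k) (lik x (σ t) z k * score x (σ t) (ρ t) z k) t := by
  unfold lik score
  refine HasDerivAt.exp (HasDerivAt.fun_sum fun j _ => ?_)
  have h := ((hp.hasDerivAt t ht j).mul_const (x k j))
  exact ((h.mul_const (z j)).sub ((h.pow 2).div_const 2)).congr_deriv (by simp; ring)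

lemma continuous_lik (x : κ → ι → ℝ) (z : ι → ℝ) (k : κ) :
    Continuous fun σ => lik x σ z k := by
  unfold lik; fun_prop

variable [Fintype κ]

lemma sum_lik_pos [Nonempty κ] (x : κ → ι → ℝ) (σ z : ι → ℝ) : 0 < ∑ k, lik x σ z k :=
  Finset.sum_pos (fun k _ => lik_pos x σ z k) Finset.univ_nonempty

lemma sum_mul_score (x : κ → ι → ℝ) (σ ρ z : ι → ℝ) (w : κ → ℝ) :
    ∑ k, w k * score x σ ρ z k =
      ∑ j, ρ j * (z j * (∑ k, w k * x k j) - σ j * ∑ k, w k * x k j ^ 2) := by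
  simp only [score, Finset.mul_sum, ← Finset.sum_sub_distrib]
  rw [Finset.sum_comm]
  exact Finset.sum_congr rfl fun j _ => Finset.sum_congr rfl fun k _ => by ring

/-- For bounded gains the logarithms of all likelihoods grow at most linearly in the observation. -/
lemma exists_abs_log_lik_le (x : κ → ι → ℝ) (hb : ∃ R, ∀ t ∈ s, ∀ j, |σ t j| ≤ R) :
    ∃ C, 0 ≤ C ∧ ∀ t ∈ s, ∀ (z : ι → ℝ) (k : κ),
      |∑ j, (σ t j * x k j * z j - (σ t j * x k j) ^ 2 / 2)| ≤ C * (1 + ∑ j, |z j|) := by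
  obtain ⟨R, hR⟩ := hb
  set A := ∑ k, ∑ j, |x k j| with hA
  have hA0 : 0 ≤ A := Finset.sum_nonneg fun _ _ => Finset.sum_nonneg fun _ _ => abs_nonneg _
  have hxA : ∀ k j, |x k j| ≤ A := fun k j =>
    (Finset.single_le_sum (f := fun j => |x k j|) (fun _ _ => abs_nonneg _)
      (Finset.mem_univ j)).trans
      (Finset.single_le_sum (f := fun k => ∑ j, |x k j|)
        (fun _ _ => Finset.sum_nonneg fun _ _ => abs_nonneg _) (Finset.mem_univ k))
  set D := |R| * A with hD
  have hD0 : 0 ≤ D := by positivity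
  refine ⟨D + Fintype.card ι * D ^ 2, by positivity, fun t ht z k => ?_⟩
  have hy : ∀ j, |σ t j * x k j| ≤ D := fun j => by
    rw [abs_mul]
    exact mul_le_mul ((hR t ht j).trans (le_abs_self R)) (hxA k j) (abs_nonneg _) (abs_nonneg _)
  have h1 : ∀ j, |σ t j * x k j * z j - (σ t j * x k j) ^ 2 / 2| ≤ D * |z j| + D ^ 2 := fun j => by
    refine (abs_sub _ _).trans ?_
    have h2 : (σ t j * x k j) ^ 2 ≤ D ^ 2 := sq_le_sq' (abs_le.1 (hy j)).1 (abs_le.1 (hy j)).2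
    rw [abs_mul, abs_of_nonneg (by positivity : 0 ≤ (σ t j * x k j) ^ 2 / 2)]
    nlinarith [mul_le_mul_of_nonneg_right (hy j) (abs_nonneg (z j)), sq_nonneg (σ t j * x k j)]
  calc _ ≤ ∑ j, (D * |z j| + D ^ 2) :=
        (Finset.abs_sum_le_sum_abs _ _).trans (Finset.sum_le_sum fun j _ => h1 j)
    _ = D * (∑ j, |z j|) + Fintype.card ι * D ^ 2 := by
        simp [Finset.sum_add_distrib, Finset.mul_sum]
    _ ≤ _ := by
        have h3 : 0 ≤ ∑ j, |z j| := Finset.sum_nonneg fun _ _ => abs_nonneg _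
        have h4 : 0 ≤ (Fintype.card ι : ℝ) * D ^ 2 := by positivity
        nlinarith [mul_nonneg h4 h3]

lemma expGrowth_lik (x : κ → ι → ℝ) (hb : ∃ R, ∀ t ∈ s, ∀ j, |σ t j| ≤ R) (k : κ) :
    ExpGrowth s fun t z => lik x (σ t) z k := by
  obtain ⟨C, hC, h⟩ := exists_abs_log_lik_le x hb
  refine ⟨fun t _ => measurable_lik x _ k, C, hC, fun t ht z => ?_⟩
  rw [abs_of_pos (lik_pos _ _ _ _)]
  exact Real.exp_le_exp.2 ((le_abs_self _).trans (h t ht z k))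

lemma expGrowth_sum_lik_mul (x : κ → ι → ℝ) (hb : ∃ R, ∀ t ∈ s, ∀ j, |σ t j| ≤ R) (f : κ → ℝ) :
    ExpGrowth s fun t z => ∑ k, lik x (σ t) z k * f k :=
  ExpGrowth.sum _ fun k => (expGrowth_lik x hb k).mul (.const (f k))

lemma expGrowth_sum_lik (x : κ → ι → ℝ) (hb : ∃ R, ∀ t ∈ s, ∀ j, |σ t j| ≤ R) :
    ExpGrowth s fun t z => ∑ k, lik x (σ t) z k :=
  ExpGrowth.sum _ fun k => expGrowth_lik x hb k

lemma expGrowth_wmean_lik (x : κ → ι → ℝ) (σ : ℝ → ι → ℝ) (f : κ → ℝ) :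
    ExpGrowth s fun t z => wmean (lik x (σ t) z) f := by
  refine .of_bounded (fun t _ => ?_) fun t _ z => abs_wmean_le (lik_pos x (σ t) z) f
  have := measurable_lik x (σ t)
  unfold wmean
  fun_prop

lemma expGrowth_wcov_lik (x : κ → ι → ℝ) (σ : ℝ → ι → ℝ) (f f' : κ → ℝ) :
    ExpGrowth s fun t z => wcov (lik x (σ t) z) f f' :=
  (expGrowth_wmean_lik x σ _).sub ((expGrowth_wmean_lik x σ f).mul (expGrowth_wmean_lik x σ f'))

lemma expGrowth_log_sum_lik [Nonempty κ] (x : κ → ι → ℝ)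
    (hb : ∃ R, ∀ t ∈ s, ∀ j, |σ t j| ≤ R) :
    ExpGrowth s fun t z => Real.log (∑ k, lik x (σ t) z k) := by
  obtain ⟨C, hC, h⟩ := exists_abs_log_lik_le x hb
  obtain ⟨-, C', hC', h'⟩ := expGrowth_sum_lik x hb
  have hm : ∀ t ∈ s, Measurable fun z => Real.log (∑ k, lik x (σ t) z k) := fun t _ =>
    (Finset.measurable_sum _ fun k _ => measurable_lik x (σ t) k).log
  refine ⟨hm, C + C', by positivity, fun t ht z => ?_⟩
  have hpos := sum_lik_pos x (σ t) z
  have h1 := one_le_one_add_sum_abs z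
  have hup : Real.log (∑ k, lik x (σ t) z k) ≤ C' * (1 + ∑ j, |z j|) := by
    rw [Real.log_le_iff_le_exp hpos]
    exact (le_abs_self _).trans (h' t ht z)
  -- one single likelihood bounds the sum from below
  have hlow : -(C * (1 + ∑ j, |z j|)) ≤ Real.log (∑ k, lik x (σ t) z k) := by
    obtain ⟨k⟩ : Nonempty κ := inferInstance
    have h2 : Real.log (lik x (σ t) z k) ≤ Real.log (∑ k, lik x (σ t) z k) :=
      Real.log_le_log (lik_pos x (σ t) z k)
        (Finset.single_le_sum (f := lik x (σ t) z) (fun k _ => (lik_pos x (σ t) z k).le)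
          (Finset.mem_univ k))
    rw [lik, Real.log_exp] at h2
    linarith [(abs_le.1 (h t ht z k)).1]
  have h3 : 0 ≤ C * (1 + ∑ j, |z j|) := by positivity
  have h4 : 0 ≤ C' * (1 + ∑ j, |z j|) := by positivity
  have h5 := Real.add_one_le_exp ((C + C') * (1 + ∑ j, |z j|))
  rw [abs_le]
  constructor <;> nlinarith

/-- The integrand `g log g`, where `g` is the sum of the likelihoods. -/
noncomputable def sumLikLog (x : κ → ι → ℝ) (σ z : ι → ℝ) : ℝ :=
  (∑ k, lik x σ z k) * Real.log (∑ k, lik x σ z k)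

lemma expGrowth_sumLikLog [Nonempty κ] (x : κ → ι → ℝ)
    (hb : ∃ R, ∀ t ∈ s, ∀ j, |σ t j| ≤ R) : ExpGrowth s fun t z => sumLikLog x (σ t) z :=
  (expGrowth_sum_lik x hb).mul (expGrowth_log_sum_lik x hb)

lemma continuous_sumLikLog [Nonempty κ] (x : κ → ι → ℝ) (z : ι → ℝ) :
    Continuous fun σ => sumLikLog x σ z := by
  have h := continuous_finsetSum Finset.univ fun k _ => continuous_lik x z k
  exact h.mul (h.log fun σ => (sum_lik_pos x σ z).ne')

variable [DecidableEq ι]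

/-- The derivative of `E[g log g]` along a path: `∑ⱼ ρⱼ σⱼ E[g mⱼ²]`, where `mⱼ` is the posterior
mean of the coordinate `j`. -/
lemma BoundedPath.hasDerivAt_integral_sumLikLog [Nonempty κ] (hp : BoundedPath s σ ρ)
    (x : κ → ι → ℝ) {t₀ : ℝ} (hs : s ∈ nhds t₀) :
    HasDerivAt (fun t => ∫ z, sumLikLog x (σ t) z ∂stdGauss ι)
      (∑ j, ρ t₀ j * σ t₀ j * ∫ z, (∑ k, lik x (σ t₀) z k) *
        wmean (lik x (σ t₀) z) (fun k => x k j) ^ 2 ∂stdGauss ι) t₀ := by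
  have hg := expGrowth_sum_lik x hp.bdd
  have hl : ExpGrowth s fun t z => 1 + Real.log (∑ k, lik x (σ t) z k) :=
    (ExpGrowth.const 1).add (expGrowth_log_sum_lik x hp.bdd)
  refine hp.hasDerivAt_integral hs
    (a := fun j t z => (∑ k, lik x (σ t) z k * x k j) * (1 + Real.log (∑ k, lik x (σ t) z k)))
    (b := fun j t z => (∑ k, lik x (σ t) z k * x k j ^ 2) *
      (1 + Real.log (∑ k, lik x (σ t) z k)))
    (c := fun j t z => (∑ k, lik x (σ t) z k) * wmean (lik x (σ t) z) (fun k => x k j) ^ 2)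
    (expGrowth_sumLikLog x hp.bdd)
    (fun j => (expGrowth_sum_lik_mul x hp.bdd _).mul hl)
    (fun j => (expGrowth_sum_lik_mul x hp.bdd _).mul hl)
    (fun j => ?_) (fun t ht z => ?_) (fun i z => ?_)
  · simp_rw [sq]
    exact hg.mul ((expGrowth_wmean_lik x σ _).mul (expGrowth_wmean_lik x σ _))
  · have hd := hasDerivAt_sum_weights fun k => hp.hasDerivAt_lik x z k ht
    have hpos := sum_lik_pos x (σ t) z
    refine (hd.fun_mul (hd.log hpos.ne')).congr_deriv ?_
    rw [mul_div_cancel₀ _ hpos.ne', sum_mul_score, Finset.sum_mul, ← Finset.sum_add_distrib]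
    exact Finset.sum_congr rfl fun j _ => by ring
  · have hw := fun k => hasDerivAt_lik_line x (σ t₀) z k i
    have hg := hasDerivAt_sum_weights hw
    have hpos := sum_lik_pos x (σ t₀) (z + (0 : ℝ) • Pi.single i 1)
    refine ((hasDerivAt_sum_mul hw fun k => x k i).fun_mul
      ((hg.log hpos.ne').const_add 1)).congr_deriv ?_
    simp only [zero_smul, add_zero] at hpos ⊢
    have e1 : ∑ k, lik x (σ t₀) z k * (x k i * (σ t₀ i * x k i)) =
        σ t₀ i * ∑ k, lik x (σ t₀) z k * x k i ^ 2 := by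
      rw [Finset.mul_sum]; exact Finset.sum_congr rfl fun k _ => by ring
    have e2 : ∑ k, lik x (σ t₀) z k * (σ t₀ i * x k i) =
        σ t₀ i * ∑ k, lik x (σ t₀) z k * x k i := by
      rw [Finset.mul_sum]; exact Finset.sum_congr rfl fun k _ => by ring
    rw [e1, e2, wmean]
    field_simp

/-- The derivative of `E[g m²]` along a path, where `m` is the posterior mean of `f`, in terms of the
posterior covariances of `f` with the coordinates. -/
lemma BoundedPath.hasDerivAt_integral_wmean_sq [Nonempty κ] (hp : BoundedPath s σ ρ)
    (x : κ → ι → ℝ) (f : κ → ℝ) {t₀ : ℝ} (hs : s ∈ nhds t₀) :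
    HasDerivAt (fun t => ∫ z, (∑ k, lik x (σ t) z k) * wmean (lik x (σ t) z) f ^ 2 ∂stdGauss ι)
      (∑ i, ρ t₀ i * σ t₀ i * ∫ z, 2 * ((∑ k, lik x (σ t₀) z k) *
        wcov (lik x (σ t₀) z) f (fun k => x k i) ^ 2) ∂stdGauss ι) t₀ := by
  have hg := expGrowth_sum_lik x hp.bdd
  have hm : ExpGrowth s fun t z => wmean (lik x (σ t) z) f := expGrowth_wmean_lik x σ f
  have hab : ∀ h : κ → ℝ, ExpGrowth s fun t z => 2 * wmean (lik x (σ t) z) f *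
      (∑ k, lik x (σ t) z k * f k * h k) -
        wmean (lik x (σ t) z) f ^ 2 * ∑ k, lik x (σ t) z k * h k := fun h => by
    simp_rw [mul_assoc, sq]
    exact ((ExpGrowth.const 2).mul (hm.mul (expGrowth_sum_lik_mul x hp.bdd _))).sub
      ((hm.mul hm).mul (expGrowth_sum_lik_mul x hp.bdd _))
  refine hp.hasDerivAt_integral hs
    (a := fun i t z => 2 * wmean (lik x (σ t) z) f * (∑ k, lik x (σ t) z k * f k * x k i) -
      wmean (lik x (σ t) z) f ^ 2 * ∑ k, lik x (σ t) z k * x k i)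
    (b := fun i t z => 2 * wmean (lik x (σ t) z) f * (∑ k, lik x (σ t) z k * f k * x k i ^ 2) -
      wmean (lik x (σ t) z) f ^ 2 * ∑ k, lik x (σ t) z k * x k i ^ 2)
    (c := fun i t z => 2 * ((∑ k, lik x (σ t) z k) *
        wcov (lik x (σ t) z) f (fun k => x k i) ^ 2))
    ?_ (fun i => hab _) (fun i => hab _) (fun i => ?_) (fun t ht z => ?_) (fun i z => ?_)
  · simp_rw [sq]
    exact hg.mul (hm.mul hm)
  · simp_rw [sq]
    exact (ExpGrowth.const 2).mul
      (hg.mul ((expGrowth_wcov_lik x σ _ _).mul (expGrowth_wcov_lik x σ _ _)))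
  · have hw := fun k => hp.hasDerivAt_lik x z k ht
    have hpos := sum_lik_pos x (σ t) z
    refine ((hasDerivAt_sum_weights hw).fun_mul
      ((hasDerivAt_wmean hw hpos f).fun_pow 2)).congr_deriv ?_
    have e1 := sum_mul_wcov hpos f (score x (σ t) (ρ t) z)
    have e2 : ∑ k, lik x (σ t) z k * (f k * score x (σ t) (ρ t) z k) =
        ∑ k, lik x (σ t) z k * f k * score x (σ t) (ρ t) z k :=
      Finset.sum_congr rfl fun k _ => by ring
    rw [e2, sum_mul_score x _ _ _ fun k => lik x (σ t) z k * f k, sum_mul_score] at e1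
    rw [sum_mul_score]
    trans 2 * wmean (lik x (σ t) z) f * (∑ j, ρ t j * (z j * (∑ k, lik x (σ t) z k * f k * x k j) -
        σ t j * ∑ k, lik x (σ t) z k * f k * x k j ^ 2)) - wmean (lik x (σ t) z) f ^ 2 *
        ∑ j, ρ t j * (z j * (∑ k, lik x (σ t) z k * x k j) -
          σ t j * ∑ k, lik x (σ t) z k * x k j ^ 2)
    · push_cast
      linear_combination (2 * wmean (lik x (σ t) z) f) * e1
    · rw [Finset.mul_sum, Finset.mul_sum, ← Finset.sum_sub_distrib]
      exact Finset.sum_congr rfl fun j _ => by ring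
  · have hw := fun k => hasDerivAt_lik_line x (σ t₀) z k i
    have hpos := sum_lik_pos x (σ t₀) (z + (0 : ℝ) • Pi.single i 1)
    have hm := hasDerivAt_wmean hw hpos f
    have hfx : HasDerivAt (fun τ : ℝ => ∑ k, lik x (σ t₀) (z + τ • Pi.single i 1) k * f k * x k i)
        (∑ k, lik x (σ t₀) (z + (0 : ℝ) • Pi.single i 1) k * (f k * x k i * (σ t₀ i * x k i)))
        0 := by
      simpa only [mul_assoc] using hasDerivAt_sum_mul hw fun k => f k * x k i
    refine (((hm.const_mul 2).fun_mul hfx).fun_sub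
      ((hm.fun_pow 2).fun_mul (hasDerivAt_sum_mul hw fun k => x k i))).congr_deriv ?_
    simp only [zero_smul, add_zero] at hpos ⊢
    have e1 : ∑ k, lik x (σ t₀) z k * (x k i * (σ t₀ i * x k i)) =
        σ t₀ i * ∑ k, lik x (σ t₀) z k * x k i ^ 2 := by
      rw [Finset.mul_sum]; exact Finset.sum_congr rfl fun k _ => by ring
    have e2 : ∑ k, lik x (σ t₀) z k * (f k * x k i * (σ t₀ i * x k i)) =
        σ t₀ i * ∑ k, lik x (σ t₀) z k * f k * x k i ^ 2 := by
      rw [Finset.mul_sum]; exact Finset.sum_congr rfl fun k _ => by ring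
    have e3 := sum_mul_wcov hpos f fun k => x k i
    simp only [← mul_assoc] at e3
    rw [e1, e2, wcov_const_mul]
    push_cast
    linear_combination (-2 * σ t₀ i * wcov (lik x (σ t₀) z) f fun k => x k i) * e3

end Likelihood

/-! ### Concavity, monotonicity and symmetry of the mutual information -/

section Info

variable {ι κ : Type*} [Fintype ι] [Fintype κ]

/-- The mutual information between a uniform index `k` and the observation of `x k` through parallel
Gaussian channels with gains `σ`, in nats, up to the factor `1 / |κ|` and the constant `log |κ|`. The
integrals for the one-point families `fun _ : Unit => x k` are the terms `E[ℓ log ℓ]` of the single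
likelihoods; written in this form, they obey the same differentiation rules as `E[g log g]`. -/
noncomputable def info (x : κ → ι → ℝ) (σ : ι → ℝ) : ℝ :=
  (∑ k, ∫ z, sumLikLog (fun _ : Unit => x k) σ z ∂stdGauss ι) -
    ∫ z, sumLikLog x σ z ∂stdGauss ι

/-- The mean square error, up to the factor `1 / |κ|`, of the posterior mean of the coordinate `j`
of `x k`, as the expected posterior variance. -/
noncomputable def mmse (x : κ → ι → ℝ) (σ : ι → ℝ) (j : ι) : ℝ :=
  ∫ z, (∑ k, lik x σ z k) * wcov (lik x σ z) (fun k => x k j) (fun k => x k j) ∂stdGauss ι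

lemma exists_abs_le_const (σ : ι → ℝ) :
    ∃ R, ∀ t ∈ ({0} : Set ℝ), ∀ j, |(fun _ : ℝ => σ) t j| ≤ R :=
  ⟨∑ j, |σ j|, fun _ _ j =>
    Finset.single_le_sum (f := fun j => |σ j|) (fun _ _ => abs_nonneg _) (Finset.mem_univ j)⟩

lemma integrable_sum_lik_mul_wcov_mul (x : κ → ι → ℝ) (σ : ι → ℝ) (f f' h h' : κ → ℝ) :
    Integrable (fun z => (∑ k, lik x σ z k) * (wcov (lik x σ z) f f' * wcov (lik x σ z) h h'))
      (stdGauss ι) :=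
  ((expGrowth_sum_lik x (exists_abs_le_const σ)).mul
    ((expGrowth_wcov_lik x (fun _ => σ) f f').mul
      (expGrowth_wcov_lik x (fun _ => σ) h h'))).integrable rfl

lemma integrable_sum_lik_mul_wcov (x : κ → ι → ℝ) (σ : ι → ℝ) (f f' : κ → ℝ) :
    Integrable (fun z => (∑ k, lik x σ z k) * wcov (lik x σ z) f f') (stdGauss ι) :=
  ((expGrowth_sum_lik x (exists_abs_le_const σ)).mul
    (expGrowth_wcov_lik x (fun _ => σ) f f')).integrable rfl

lemma integrable_sum_lik_mul_wmean_sq (x : κ → ι → ℝ) (σ : ι → ℝ) (f : κ → ℝ) :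
    Integrable (fun z => (∑ k, lik x σ z k) * wmean (lik x σ z) f ^ 2) (stdGauss ι) := by
  simp_rw [sq]
  exact ((expGrowth_sum_lik x (exists_abs_le_const σ)).mul
    ((expGrowth_wmean_lik x (fun _ => σ) f).mul (expGrowth_wmean_lik x (fun _ => σ) f))).integrable
      rfl

/-- Up to normalization, the mean square error is the second moment of the coordinate less the
second moment of its posterior mean. -/
lemma mmse_eq [Nonempty κ] (x : κ → ι → ℝ) (σ : ι → ℝ) (j : ι) :
    mmse x σ j = (∑ k, ∫ z, (∑ i, lik (fun _ : Unit => x k) σ z i) *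
        wmean (lik (fun _ : Unit => x k) σ z) (fun _ => x k j) ^ 2 ∂stdGauss ι) -
      ∫ z, (∑ k, lik x σ z k) * wmean (lik x σ z) (fun k => x k j) ^ 2 ∂stdGauss ι := by
  rw [← integral_finsetSum _ fun k _ =>
      integrable_sum_lik_mul_wmean_sq (fun _ : Unit => x k) σ fun _ => x k j,
    ← integral_sub (integrable_finsetSum _ fun k _ =>
      integrable_sum_lik_mul_wmean_sq (fun _ : Unit => x k) σ fun _ => x k j)
      (integrable_sum_lik_mul_wmean_sq x σ _), mmse]
  congr with z
  have hpos := sum_lik_pos x σ z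
  rw [sum_mul_wcov hpos, ← sum_mul_wmean hpos fun k => x k j]
  have h : ∀ k, (∑ i, lik (fun _ : Unit => x k) σ z i) *
      wmean (lik (fun _ : Unit => x k) σ z) (fun _ => x k j) ^ 2 =
        lik x σ z k * (x k j * x k j) := fun k => by
    have h1 := lik_pos x σ z k
    simp only [wmean, Finset.univ_unique, Finset.sum_singleton, PUnit.default_eq_unit,
      lik_unit x σ z k]
    field_simp
  simp_rw [h]
  ring

lemma mmse_nonneg [Nonempty κ] (x : κ → ι → ℝ) (σ : ι → ℝ) (j : ι) : 0 ≤ mmse x σ j :=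
  integral_nonneg fun z => mul_nonneg (sum_lik_pos x σ z).le
    (wcov_self_nonneg (fun k => (lik_pos x σ z k).le) (sum_lik_pos x σ z) _)

lemma mmse_pos (x : κ → ι → ℝ) (σ : ι → ℝ) {j : ι} {k l : κ} (hkl : x k j ≠ x l j) :
    0 < mmse x σ j := by
  have : Nonempty κ := ⟨k⟩
  have hpos : ∀ z, 0 < (∑ k, lik x σ z k) *
      wcov (lik x σ z) (fun k => x k j) (fun k => x k j) := fun z =>
    mul_pos (sum_lik_pos x σ z) (wcov_self_pos (f := fun k => x k j) (lik_pos x σ z) hkl)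
  rw [mmse, integral_pos_iff_support_of_nonneg (fun z => (hpos z).le)
    (integrable_sum_lik_mul_wcov x σ _ _)]
  have : Function.support (fun z => (∑ k, lik x σ z k) *
      wcov (lik x σ z) (fun k => x k j) (fun k => x k j)) = Set.univ :=
    Set.eq_univ_of_forall fun z => (hpos z).ne'
  rw [this, measure_univ]
  exact one_pos

variable {s : Set ℝ} {σ ρ : ℝ → ι → ℝ}

/-- The derivative of the mutual information with respect to the squared gains is half of the
mean square error. -/
lemma BoundedPath.hasDerivAt_info [DecidableEq ι] [Nonempty κ] (hp : BoundedPath s σ ρ)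
    (x : κ → ι → ℝ) {t₀ : ℝ} (hs : s ∈ nhds t₀) :
    HasDerivAt (fun t => info x (σ t)) (∑ j, ρ t₀ j * σ t₀ j * mmse x (σ t₀) j) t₀ := by
  refine ((HasDerivAt.fun_sum fun k _ => hp.hasDerivAt_integral_sumLikLog
    (fun _ : Unit => x k) hs).fun_sub (hp.hasDerivAt_integral_sumLikLog x hs)).congr_deriv ?_
  rw [Finset.sum_comm, ← Finset.sum_sub_distrib]
  refine Finset.sum_congr rfl fun j _ => ?_
  rw [mmse_eq, ← Finset.mul_sum, mul_sub]

/-- The derivative of the mean square error with respect to the squared gains is minus the expected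
square of the posterior covariances. -/
lemma BoundedPath.hasDerivAt_mmse [DecidableEq ι] [Nonempty κ] (hp : BoundedPath s σ ρ)
    (x : κ → ι → ℝ) (j : ι) {t₀ : ℝ} (hs : s ∈ nhds t₀) :
    HasDerivAt (fun t => mmse x (σ t) j) (-∑ i, 2 * (ρ t₀ i * σ t₀ i) *
      ∫ z, (∑ k, lik x (σ t₀) z k) *
        wcov (lik x (σ t₀) z) (fun k => x k j) (fun k => x k i) ^ 2 ∂stdGauss ι) t₀ := by
  simp_rw [mmse_eq]
  refine ((HasDerivAt.fun_sum fun k _ => hp.hasDerivAt_integral_wmean_sq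
    (fun _ : Unit => x k) (fun _ => x k j) hs).fun_sub
      (hp.hasDerivAt_integral_wmean_sq x (fun k => x k j) hs)).congr_deriv ?_
  -- the covariance of a single point vanishes
  have h0 : ∀ k i z, wcov (lik (fun _ : Unit => x k) (σ t₀) z) (fun _ => x k j)
      (fun _ => x k i) = 0 := fun k i z => by
    have h1 := lik_pos (fun _ : Unit => x k) (σ t₀) z ()
    simp only [wcov, wmean, Finset.univ_unique, Finset.sum_singleton, PUnit.default_eq_unit]
    field_simp
    ring
  simp only [h0, integral_const_mul]
  simp
  exact Finset.sum_congr rfl fun i _ => by ring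

lemma continuousOn_info [Nonempty κ] (x : κ → ι → ℝ) (hb : ∃ R, ∀ t ∈ s, ∀ j, |σ t j| ≤ R)
    (hc : ContinuousOn σ s) : ContinuousOn (fun t => info x (σ t)) s := by
  refine ContinuousOn.sub (continuousOn_finsetSum _ fun k _ => ?_) ?_
  · exact (expGrowth_sumLikLog (fun _ : Unit => x k) hb).continuousOn_integral fun z =>
      (continuous_sumLikLog (fun _ : Unit => x k) z).comp_continuousOn hc
  · exact (expGrowth_sumLikLog x hb).continuousOn_integral fun z =>
      (continuous_sumLikLog x z).comp_continuousOn hc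

/-- The square roots of a segment of squared gains form a bounded path away from the end points.
In a coordinate where both ends vanish the path is constant, and its derivative is `0 / 0 = 0`. -/
lemma exists_boundedPath_sqrt {u w : ι → ℝ} (hu : ∀ j, 0 ≤ u j) (hw : ∀ j, 0 ≤ w j) {t₀ : ℝ}
    (ht₀ : t₀ ∈ Set.Ioo (0 : ℝ) 1) :
    ∃ s ∈ nhds t₀, BoundedPath s (fun t j => √(u j + t * (w j - u j)))
      (fun t j => (w j - u j) / (2 * √(u j + t * (w j - u j)))) := by
  obtain ⟨h0, h1⟩ := ht₀
  have hmin := lt_min h0 (sub_pos.2 h1)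
  obtain ⟨a, ha0, hat, hat'⟩ : ∃ a, 0 < a ∧ a < t₀ ∧ t₀ < 1 - a :=
    ⟨min t₀ (1 - t₀) / 2, by positivity, by linarith [min_le_left t₀ (1 - t₀)],
      by linarith [min_le_right t₀ (1 - t₀)]⟩
  have hlow : ∀ t ∈ Set.Icc a (1 - a), ∀ j, a * (u j + w j) ≤ u j + t * (w j - u j) :=
    fun t ht j => by nlinarith [hu j, hw j, ht.1, ht.2]
  have hup : ∀ t ∈ Set.Icc a (1 - a), ∀ j, u j + t * (w j - u j) ≤ u j + w j :=
    fun t ht j => by nlinarith [hu j, hw j, ht.1, ht.2]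
  refine ⟨Set.Icc a (1 - a), Icc_mem_nhds hat hat', ⟨fun t ht j => ?_, ?_, ?_⟩⟩
  · rcases (add_nonneg (hu j) (hw j)).eq_or_lt with h | h
    · have e1 : u j = 0 := by linarith [hu j, hw j]
      have e2 : w j = 0 := by linarith [hu j, hw j]
      simpa [e1, e2] using hasDerivAt_const t (0 : ℝ)
    · have hpos : 0 < u j + t * (w j - u j) := (mul_pos ha0 h).trans_le (hlow t ht j)
      exact ((((hasDerivAt_id t).mul_const (w j - u j)).const_add (u j)).sqrt
        hpos.ne').congr_deriv (by simp)
  · refine ⟨∑ j, √(u j + w j), fun t ht j => ?_⟩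
    rw [abs_of_nonneg (Real.sqrt_nonneg _)]
    exact (Real.sqrt_le_sqrt (hup t ht j)).trans (Finset.single_le_sum
      (f := fun j => √(u j + w j)) (fun _ _ => Real.sqrt_nonneg _) (Finset.mem_univ j))
  · refine ⟨∑ j, |w j - u j| / (2 * √(a * (u j + w j))), fun t ht j => ?_⟩
    refine le_trans ?_ (Finset.single_le_sum
      (f := fun j => |w j - u j| / (2 * √(a * (u j + w j)))) (fun _ _ => by positivity)
      (Finset.mem_univ j))
    rcases (add_nonneg (hu j) (hw j)).eq_or_lt with h | h
    · have e1 : u j = 0 := by linarith [hu j, hw j]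
      have e2 : w j = 0 := by linarith [hu j, hw j]
      simp [e1, e2]
    · have hpos : 0 < √(a * (u j + w j)) := Real.sqrt_pos.2 (mul_pos ha0 h)
      rw [abs_div, abs_of_nonneg (by positivity : 0 ≤ 2 * √(u j + t * (w j - u j)))]
      have := Real.sqrt_le_sqrt (hlow t ht j)
      gcongr

/-- Concavity along a segment: the second derivative is, up to a negative factor, the expectation of
the quadratic form of the squared posterior covariances. -/
lemma concaveOn_info_segment [Nonempty κ] (x : κ → ι → ℝ) {u w : ι → ℝ} (hu : ∀ j, 0 ≤ u j)
    (hw : ∀ j, 0 ≤ w j) :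
    ConcaveOn ℝ (Set.Icc 0 1) fun t : ℝ => info x fun j => √(u j + t * (w j - u j)) := by
  classical
  set σ : ℝ → ι → ℝ := fun t j => √(u j + t * (w j - u j)) with hσ
  -- `ρ σ` is half of the constant velocity `w - u` of the squared gains
  have hv : ∀ t ∈ Set.Ioo (0 : ℝ) 1, ∀ j,
      (w j - u j) / (2 * √(u j + t * (w j - u j))) * σ t j = (w j - u j) / 2 := by
    intro t ht j
    rcases (add_nonneg (hu j) (hw j)).eq_or_lt with h | h
    · have e1 : u j = 0 := by linarith [hu j, hw j]
      have e2 : w j = 0 := by linarith [hu j, hw j]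
      simp [e1, e2]
    · have hpos : 0 < u j + t * (w j - u j) := by
        have h1 : u j + t * (w j - u j) = (1 - t) * u j + t * w j := by ring
        rw [h1]
        rcases (hu j).eq_or_lt with h2 | h2
        · rw [← h2, mul_zero, zero_add]; exact mul_pos ht.1 (by linarith)
        · exact add_pos_of_pos_of_nonneg (mul_pos (by linarith [ht.2]) h2)
            (mul_nonneg ht.1.le (hw j))
      have := Real.sqrt_pos.2 hpos
      change (w j - u j) / (2 * √(u j + t * (w j - u j))) * √(u j + t * (w j - u j)) = _
      generalize √(u j + t * (w j - u j)) = r at this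
      field_simp
  refine concaveOn_of_hasDerivWithinAt2_nonpos (convex_Icc 0 1)
    (f' := fun t => ∑ j, (w j - u j) / 2 * mmse x (σ t) j)
    (f'' := fun t => ∑ j, (w j - u j) / 2 * -∑ i, 2 * ((w i - u i) / 2) *
      ∫ z, (∑ k, lik x (σ t) z k) *
        wcov (lik x (σ t) z) (fun k => x k j) (fun k => x k i) ^ 2 ∂stdGauss ι) ?_ ?_ ?_ ?_
  · refine continuousOn_info x (σ := σ) ⟨∑ j, √(u j + w j), fun t ht j => ?_⟩ ?_
    · rw [abs_of_nonneg (Real.sqrt_nonneg _)]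
      refine (Real.sqrt_le_sqrt ?_).trans (Finset.single_le_sum
        (f := fun j => √(u j + w j)) (fun _ _ => Real.sqrt_nonneg _) (Finset.mem_univ j))
      nlinarith [hu j, hw j, ht.1, ht.2]
    · refine Continuous.continuousOn ?_
      simp only [hσ]
      fun_prop
  · intro t ht
    rw [interior_Icc] at ht
    obtain ⟨s, hs, hp⟩ := exists_boundedPath_sqrt hu hw ht
    refine ((hp.hasDerivAt_info x hs).congr_deriv ?_).hasDerivWithinAt
    exact Finset.sum_congr rfl fun j _ => by rw [← hv t ht j]
  · intro t ht
    rw [interior_Icc] at ht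
    obtain ⟨s, hs, hp⟩ := exists_boundedPath_sqrt hu hw ht
    refine (HasDerivAt.fun_sum fun j _ =>
      ((hp.hasDerivAt_mmse x j hs).const_mul ((w j - u j) / 2)).congr_deriv ?_).hasDerivWithinAt
    congr 2
    exact Finset.sum_congr rfl fun i _ => by rw [← hv t ht i]
  · intro t ht
    have hsq : ∀ j i, Integrable (fun z => (∑ k, lik x (σ t) z k) *
        wcov (lik x (σ t) z) (fun k => x k j) (fun k => x k i) ^ 2) (stdGauss ι) := fun j i => by
      simp_rw [sq]
      exact integrable_sum_lik_mul_wcov_mul x (σ t) _ _ _ _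
    have h1 : 0 ≤ ∫ z, (∑ k, lik x (σ t) z k) * ∑ j, ∑ i, (w j - u j) * (w i - u i) *
        wcov (lik x (σ t) z) (fun k => x k j) (fun k => x k i) ^ 2 ∂stdGauss ι :=
      integral_nonneg fun z => mul_nonneg (sum_lik_pos x (σ t) z).le
        (sum_mul_wcov_sq_nonneg (fun k => (lik_pos x (σ t) z k).le) (sum_lik_pos x (σ t) z)
          (fun j k => x k j) fun j => w j - u j)
    have h2 : ∫ z, (∑ k, lik x (σ t) z k) * ∑ j, ∑ i, (w j - u j) * (w i - u i) *
        wcov (lik x (σ t) z) (fun k => x k j) (fun k => x k i) ^ 2 ∂stdGauss ι =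
        ∑ j, ∑ i, (w j - u j) * (w i - u i) * ∫ z, (∑ k, lik x (σ t) z k) *
          wcov (lik x (σ t) z) (fun k => x k j) (fun k => x k i) ^ 2 ∂stdGauss ι := by
      simp_rw [Finset.mul_sum, mul_left_comm (∑ k, lik x (σ t) _ k)]
      rw [integral_finsetSum _ fun j _ => integrable_finsetSum _ fun i _ =>
        (hsq j i).const_mul _]
      refine Finset.sum_congr rfl fun j _ => ?_
      rw [integral_finsetSum _ fun i _ => (hsq j i).const_mul _]
      exact Finset.sum_congr rfl fun i _ => integral_const_mul _ _
    rw [h2] at h1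
    have h3 : ∑ j, (w j - u j) / 2 * -∑ i, 2 * ((w i - u i) / 2) *
      ∫ z, (∑ k, lik x (σ t) z k) *
        wcov (lik x (σ t) z) (fun k => x k j) (fun k => x k i) ^ 2 ∂stdGauss ι =
        -(1 / 2) * ∑ j, ∑ i, (w j - u j) * (w i - u i) * ∫ z, (∑ k, lik x (σ t) z k) *
          wcov (lik x (σ t) z) (fun k => x k j) (fun k => x k i) ^ 2 ∂stdGauss ι := by
      rw [Finset.mul_sum]
      refine Finset.sum_congr rfl fun j _ => ?_
      rw [← Finset.sum_neg_distrib, Finset.mul_sum, Finset.mul_sum]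
      exact Finset.sum_congr rfl fun i _ => by ring
    rw [h3]
    linarith

/-- The mutual information is a concave function of the squared gains. -/
theorem concaveOn_info [Nonempty κ] (x : κ → ι → ℝ) :
    ConcaveOn ℝ {u : ι → ℝ | ∀ j, 0 ≤ u j} fun u => info x fun j => √(u j) := by
  refine ⟨fun u hu w hw a b ha hb _ j => ?_, fun u hu w hw a b ha hb hab => ?_⟩
  · exact add_nonneg (mul_nonneg ha (hu j)) (mul_nonneg hb (hw j))
  · have h := (concaveOn_info_segment x hu hw).2 (Set.left_mem_Icc.2 zero_le_one)
      (Set.right_mem_Icc.2 zero_le_one) ha hb hab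
    simp only [zero_mul, add_zero, one_mul, add_sub_cancel, smul_eq_mul, mul_zero, mul_one,
      zero_add] at h
    have e : (fun j => √((a • u + b • w) j)) = fun j => √(u j + b * (w j - u j)) := by
      ext j
      rw [Pi.add_apply, Pi.smul_apply, Pi.smul_apply, smul_eq_mul, smul_eq_mul]
      congr 1
      linear_combination (u j) * hab
    simp only [smul_eq_mul, e]
    exact h

lemma hasDerivAt_info_ray [Nonempty κ] (x : κ → ι → ℝ) (σ : ι → ℝ) (t : ℝ) :
    HasDerivAt (fun t : ℝ => info x fun j => t * σ j)
      (∑ j, σ j * (t * σ j) * mmse x (fun j => t * σ j) j) t := by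
  classical
  have hp : BoundedPath (Set.Icc (t - 1) (t + 1)) (fun t j => t * σ j) (fun _ j => σ j) := by
    refine ⟨fun t _ j => by simpa using (hasDerivAt_id t).mul_const (σ j), ?_, ?_⟩
    · refine ⟨(|t| + 1) * ∑ j, |σ j|, fun τ hτ j => ?_⟩
      rw [abs_mul]
      have h1 : |τ| ≤ |t| + 1 := by
        rw [abs_le]
        constructor <;> linarith [hτ.1, hτ.2, le_abs_self t, neg_abs_le t]
      gcongr
      exact Finset.single_le_sum (f := fun j => |σ j|) (fun _ _ => abs_nonneg _)
        (Finset.mem_univ j)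
    · exact ⟨∑ j, |σ j|, fun _ _ j => Finset.single_le_sum (f := fun j => |σ j|)
        (fun _ _ => abs_nonneg _) (Finset.mem_univ j)⟩
  exact hp.hasDerivAt_info x (Icc_mem_nhds (by linarith) (by linarith))

lemma monotoneOn_info_ray [Nonempty κ] (x : κ → ι → ℝ) (σ : ι → ℝ) :
    MonotoneOn (fun t : ℝ => info x fun j => t * σ j) (Set.Ici 0) := by
  refine monotoneOn_of_deriv_nonneg (convex_Ici 0)
    (fun t _ => (hasDerivAt_info_ray x σ t).continuousAt.continuousWithinAt)
    (fun t _ => (hasDerivAt_info_ray x σ t).differentiableAt.differentiableWithinAt)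
    fun t ht => ?_
  rw [interior_Ici] at ht
  rw [(hasDerivAt_info_ray x σ t).deriv]
  refine Finset.sum_nonneg fun j _ => mul_nonneg ?_ (mmse_nonneg _ _ _)
  rw [mul_left_comm]
  exact mul_nonneg ht.le (mul_self_nonneg _)

lemma strictMonoOn_info_ray (x : κ → ι → ℝ) {σ : ι → ℝ} {j : ι} {k l : κ} (hσ : σ j ≠ 0)
    (hkl : x k j ≠ x l j) :
    StrictMonoOn (fun t : ℝ => info x fun j => t * σ j) (Set.Ici 0) := by
  have : Nonempty κ := ⟨k⟩
  refine strictMonoOn_of_deriv_pos (convex_Ici 0)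
    (fun t _ => (hasDerivAt_info_ray x σ t).continuousAt.continuousWithinAt) fun t ht => ?_
  rw [interior_Ici] at ht
  rw [(hasDerivAt_info_ray x σ t).deriv]
  have ht0 : 0 < t := ht
  refine Finset.sum_pos' (fun j _ => mul_nonneg ?_ (mmse_nonneg _ _ _))
    ⟨j, Finset.mem_univ j, mul_pos ?_ (mmse_pos x _ hkl)⟩
  · rw [mul_left_comm]
    exact mul_nonneg ht0.le (mul_self_nonneg _)
  · rw [mul_left_comm]
    exact mul_pos ht0 (mul_self_pos.2 hσ)

lemma measurePreserving_signedPerm (e : Equiv.Perm ι) {ε : ι → ℝ} (hε : ∀ j, ε j = 1 ∨ ε j = -1) :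
    MeasurePreserving (fun (z : ι → ℝ) i => ε (e.symm i) * z (e.symm i)) (stdGauss ι)
      (stdGauss ι) := by
  have h1 : MeasurePreserving (fun (z : ι → ℝ) i => ε i * z i) (stdGauss ι) (stdGauss ι) := by
    refine measurePreserving_pi _ _ (f := fun i y => ε i * y) fun i => ⟨by fun_prop, ?_⟩
    rcases hε i with h | h
    · simp [h]
    · simp [h, gaussianReal_map_neg]
  have h2 := measurePreserving_piCongrLeft (α := fun _ : ι => ℝ) (fun _ => gaussianReal 0 1) e
  have h3 : MeasurePreserving _ (stdGauss ι) (stdGauss ι) := h2.comp h1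
  convert h3 using 1
  ext z i
  simp [MeasurableEquiv.piCongrLeft, Equiv.piCongrLeft_apply]

lemma integral_sumLikLog_signedPerm (x : κ → ι → ℝ) (σ : ι → ℝ) (e : Equiv.Perm ι) {ε : ι → ℝ}
    (hε : ∀ j, ε j = 1 ∨ ε j = -1) :
    ∫ z, sumLikLog (fun k j => ε j * x k (e j)) (fun j => σ (e j)) z ∂stdGauss ι =
      ∫ z, sumLikLog x σ z ∂stdGauss ι := by
  have hm := measurePreserving_signedPerm e hε
  have hmeas : AEStronglyMeasurable (fun z => sumLikLog x σ z)
      ((stdGauss ι).map fun (z : ι → ℝ) i => ε (e.symm i) * z (e.symm i)) := by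
    refine Measurable.aestronglyMeasurable ?_
    have := measurable_lik x σ
    unfold sumLikLog
    fun_prop
  have h1 := integral_map hm.measurable.aemeasurable hmeas
  rw [hm.map_eq] at h1
  rw [h1]
  congr with z
  have h2 : ∀ k, lik (fun k j => ε j * x k (e j)) (fun j => σ (e j)) z k =
      lik x σ (fun i => ε (e.symm i) * z (e.symm i)) k := fun k => by
    unfold lik
    conv_rhs => rw [← Equiv.sum_comp e]
    congr 1
    refine Finset.sum_congr rfl fun j _ => ?_
    rcases hε j with h | h <;> simp [h]
  simp only [sumLikLog, h2]

/-- If a signed permutation of the coordinates maps the family `x` to itself, then the mutual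
information is unchanged when the gains are permuted. -/
lemma info_comp_perm (x : κ → ι → ℝ) (σ : ι → ℝ) (e : Equiv.Perm ι) {ε : ι → ℝ}
    (hε : ∀ j, ε j = 1 ∨ ε j = -1) (τ : Equiv.Perm κ) (hτ : ∀ k j, x (τ k) j = ε j * x k (e j)) :
    info x (fun j => σ (e j)) = info x σ := by
  have h1 : ∀ k, ∫ z, sumLikLog (fun _ : Unit => x (τ k)) (fun j => σ (e j)) z ∂stdGauss ι =
      ∫ z, sumLikLog (fun _ : Unit => x k) σ z ∂stdGauss ι := fun k => by
    rw [← integral_sumLikLog_signedPerm (fun _ : Unit => x k) σ e hε]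
    simp only [← hτ]
  have h2 : ∫ z, sumLikLog x (fun j => σ (e j)) z ∂stdGauss ι =
      ∫ z, sumLikLog x σ z ∂stdGauss ι := by
    rw [← integral_sumLikLog_signedPerm x σ e hε]
    congr with z
    have h3 : ∑ k, lik x (fun j => σ (e j)) z k =
        ∑ k, lik (fun k j => ε j * x k (e j)) (fun j => σ (e j)) z k := by
      rw [← Equiv.sum_comp τ]
      simp only [lik, hτ]
    simp only [sumLikLog, h3]
  rw [info, info, h2, ← Equiv.sum_comp τ]
  simp only [h1]

end Info

/-! ### Mutual information of a uniform input and additive noise -/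

section KL

lemma lintegral_uniformOn {𝓧 : Type*} [MeasurableSpace 𝓧] [MeasurableSingletonClass 𝓧]
    (F : Finset 𝓧) (f : 𝓧 → ENNReal) :
    ∫⁻ x, f x ∂uniformOn (F : Set 𝓧) = (F.card : ENNReal)⁻¹ * ∑ x ∈ F, f x := by
  rw [uniformOn, ProbabilityTheory.cond, lintegral_smul_measure, lintegral_finset]
  simp

lemma restrict_uniformOn {𝓧 : Type*} [MeasurableSpace 𝓧] [MeasurableSingletonClass 𝓧]
    (F : Finset 𝓧) : (uniformOn (F : Set 𝓧)).restrict F = uniformOn (F : Set 𝓧) := by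
  rw [uniformOn, ProbabilityTheory.cond, Measure.restrict_smul,
    Measure.restrict_restrict F.measurableSet, Set.inter_self]

lemma integrable_uniformOn {𝓧 : Type*} [MeasurableSpace 𝓧] [MeasurableSingletonClass 𝓧]
    {F : Finset 𝓧} (hF : F.Nonempty) (f : 𝓧 → ℝ) : Integrable f (uniformOn (F : Set 𝓧)) := by
  have := isProbabilityMeasure_uniformOn F.finite_toSet hF
  rw [← restrict_uniformOn]
  exact IntegrableOn.finset

lemma integral_uniformOn {𝓧 : Type*} [MeasurableSpace 𝓧] [MeasurableSingletonClass 𝓧]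
    {F : Finset 𝓧} (hF : F.Nonempty) (f : 𝓧 → ℝ) :
    ∫ x, f x ∂uniformOn (F : Set 𝓧) = (∑ x ∈ F, f x) / F.card := by
  have := isProbabilityMeasure_uniformOn F.finite_toSet hF
  rw [← restrict_uniformOn, setIntegral_finset _ IntegrableOn.finset, Finset.sum_div]
  refine Finset.sum_congr rfl fun x hx => ?_
  have h : uniformOn (F : Set 𝓧) {x} = (F.card : ENNReal)⁻¹ := by
    rw [uniformOn, cond_apply F.measurableSet, Set.inter_singleton_of_mem hx]
    simp
  rw [Measure.real, h, ENNReal.toReal_inv, ENNReal.toReal_natCast, smul_eq_mul,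
    inv_mul_eq_div]

/-- The Kullback-Leibler divergence that defines the mutual information of `X`, uniform on `F`, and
`Y = t(X) + W`, in terms of the likelihoods `ℓ x`, the densities of `t(x) + W` with respect to the
law `N` of `W`. -/
lemma mutualInfo_uniformOn {𝓧 𝓨 : Type*} [MeasurableSpace 𝓧] [MeasurableSingletonClass 𝓧]
    [MeasurableSpace 𝓨] [Add 𝓨] [MeasurableAdd₂ 𝓨] (F : Finset 𝓧) (hF : F.Nonempty)
    (N : Measure 𝓨) [IsProbabilityMeasure N] {t : 𝓧 → 𝓨} (ht : Measurable t) {ℓ : 𝓧 → 𝓨 → ℝ}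
    (hℓ : Measurable fun p : 𝓧 × 𝓨 => ℓ p.1 p.2) (hpos : ∀ x y, 0 < ℓ x y)
    (hN : ∀ x, N.map (fun w => t x + w) = N.withDensity fun y => ENNReal.ofReal (ℓ x y))
    (hint : ∀ x, Integrable
      (fun y => ℓ x y * Real.log (ℓ x y / ((∑ x ∈ F, ℓ x y) / F.card))) N) :
    mutualInfo ((uniformOn (F : Set 𝓧)).prod N) (fun p => p.1) (fun p => t p.1 + p.2) =
      (∑ x ∈ F, ∫ y, ℓ x y * Real.log (ℓ x y / ((∑ x ∈ F, ℓ x y) / F.card)) ∂N) / F.card /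
        Real.log 2 := by
  set U := uniformOn (F : Set 𝓧) with hU
  have hUp : IsProbabilityMeasure U := isProbabilityMeasure_uniformOn F.finite_toSet hF
  have hcard : (0 : ℝ) < F.card := by exact_mod_cast hF.card_pos
  set g : 𝓨 → ℝ := fun y => (∑ x ∈ F, ℓ x y) / F.card with hg
  have hgpos : ∀ y, 0 < g y := fun y => div_pos (Finset.sum_pos (fun x _ => hpos x y) hF) hcard
  have hℓx : ∀ x, Measurable (ℓ x) := fun x => hℓ.comp measurable_prodMk_left
  have hgm : Measurable g := (Finset.measurable_sum _ fun x _ => hℓx x).div_const _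
  have hY : Measurable fun p : 𝓧 × 𝓨 => t p.1 + p.2 := (ht.comp measurable_fst).add measurable_snd
  -- the densities of the joint law and of the output law relative to `U × N` and `N`
  have hJ : (U.prod N).map (fun p => (p.1, t p.1 + p.2)) =
      (U.prod N).withDensity fun p => ENNReal.ofReal (ℓ p.1 p.2) := by
    refine Measure.ext_of_lintegral _ fun f hf => ?_
    rw [lintegral_map hf (measurable_fst.prodMk hY),
      lintegral_withDensity_eq_lintegral_mul _ hℓ.ennreal_ofReal hf,
      lintegral_prod _ (by fun_prop), lintegral_prod _ (by fun_prop)]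
    refine lintegral_congr fun x => ?_
    have hfx : Measurable fun y => f (x, y) := hf.comp measurable_prodMk_left
    have h1 := lintegral_map (μ := N) hfx (measurable_const_add (t x))
    rw [hN x, lintegral_withDensity_eq_lintegral_mul _ (hℓx x).ennreal_ofReal hfx] at h1
    exact h1.symm
  have hX : (U.prod N).map (fun p => p.1) = U := by
    simp [Measure.map_fst_prod (μ := U) (ν := N)]
  have hYl : (U.prod N).map (fun p => t p.1 + p.2) =
      N.withDensity fun y => ENNReal.ofReal (g y) := by
    have h1 : (U.prod N).map (fun p => t p.1 + p.2) =
        ((U.prod N).map fun p => (p.1, t p.1 + p.2)).map Prod.snd :=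
      (Measure.map_map measurable_snd (measurable_fst.prodMk hY)).symm
    rw [h1, hJ]
    refine Measure.ext_of_lintegral _ fun f hf => ?_
    have h2 := lintegral_withDensity_eq_lintegral_mul (U.prod N) hℓ.ennreal_ofReal
      (hf.comp measurable_snd)
    simp only [Function.comp_apply] at h2
    rw [lintegral_map hf measurable_snd, h2, lintegral_withDensity_eq_lintegral_mul _
      hgm.ennreal_ofReal hf, lintegral_prod_symm _ (by fun_prop)]
    refine lintegral_congr fun y => ?_
    simp only [Pi.mul_apply, Function.comp_apply]
    rw [lintegral_uniformOn, ← Finset.sum_mul, ← mul_assoc, hg]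
    simp only
    rw [ENNReal.ofReal_div_of_pos hcard, ENNReal.ofReal_sum_of_nonneg fun x _ => (hpos x y).le,
      ENNReal.div_eq_inv_mul, ENNReal.ofReal_natCast]
  have hPr : U.prod (N.withDensity fun y => ENNReal.ofReal (g y)) =
      (U.prod N).withDensity fun p => ENNReal.ofReal (g p.2) :=
    prod_withDensity_right hgm.ennreal_ofReal
  have hNg : IsProbabilityMeasure (N.withDensity fun y => ENNReal.ofReal (g y)) := by
    rw [← hYl]; exact Measure.isProbabilityMeasure_map hY.aemeasurable
  have hJp : IsProbabilityMeasure ((U.prod N).map fun p => (p.1, t p.1 + p.2)) :=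
    Measure.isProbabilityMeasure_map (measurable_fst.prodMk hY).aemeasurable
  have hqm : Measurable fun p : 𝓧 × 𝓨 => ENNReal.ofReal (ℓ p.1 p.2 / g p.2) :=
    (hℓ.div (hgm.comp measurable_snd)).ennreal_ofReal
  have hJQ : (U.prod N).map (fun p => (p.1, t p.1 + p.2)) =
      (U.prod (N.withDensity fun y => ENNReal.ofReal (g y))).withDensity
        fun p => ENNReal.ofReal (ℓ p.1 p.2 / g p.2) := by
    have hgm' : Measurable fun p : 𝓧 × 𝓨 => ENNReal.ofReal (g p.2) :=
      (hgm.comp measurable_snd).ennreal_ofReal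
    rw [hPr, hJ, ← withDensity_mul _ hgm' hqm]
    congr 1 with p
    rw [Pi.mul_apply, ← ENNReal.ofReal_mul (hgpos _).le, mul_div_cancel₀ _ (hgpos _).ne']
  set J := (U.prod N).map (fun p => (p.1, t p.1 + p.2)) with hJdef
  set Q := U.prod (N.withDensity fun y => ENNReal.ofReal (g y)) with hQdef
  have hac : J ≪ Q := by rw [hJQ]; exact withDensity_absolutelyContinuous _ _
  -- hence the log-likelihood ratio of the two laws is `log (ℓ / g)`
  have hllr : llr J Q =ᵐ[J] fun p => Real.log (ℓ p.1 p.2 / g p.2) := by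
    refine hac.ae_le ?_
    have h1 := Measure.rnDeriv_withDensity Q hqm
    rw [← hJQ] at h1
    filter_upwards [h1] with p hp
    rw [llr, hp, ENNReal.toReal_ofReal (div_pos (hpos _ _) (hgpos _)).le]
  rw [mutualInfo, hX, hYl]
  congr 1
  rw [InformationTheory.toReal_klDiv_of_measure_eq hac (by simp), integral_congr_ae hllr, hJ,
    integral_withDensity_eq_integral_toReal_smul hℓ.ennreal_ofReal
      (ae_of_all _ fun _ => ENNReal.ofReal_lt_top)]
  simp only [ENNReal.toReal_ofReal (hpos _ _).le, smul_eq_mul]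
  have hfm : Measurable fun p : 𝓧 × 𝓨 => ℓ p.1 p.2 * Real.log (ℓ p.1 p.2 / g p.2) :=
    hℓ.mul (hℓ.div (hgm.comp measurable_snd)).log
  rw [integral_prod _ ((integrable_prod_iff hfm.aestronglyMeasurable).2
    ⟨ae_of_all _ hint, integrable_uniformOn hF _⟩), integral_uniformOn hF]

end KL

/-! ### The block fading channel in real coordinates -/

section Channel

variable {B : ℕ}

/-- The real and imaginary parts of a complex vector, as a real vector of twice the length. -/
def realCoords (x : Fin B → ℂ) : Fin B ⊕ Fin B → ℝ :=
  Sum.elim (fun b => (x b).re) fun b => (x b).im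

/-- The complex vector with real and imaginary parts `c * z`. -/
def ofRealCoords (c : ℝ) (z : Fin B ⊕ Fin B → ℝ) : Fin B → ℂ :=
  fun b => ⟨c * z (.inl b), c * z (.inr b)⟩

/-- The gains of the `2B` real channels, in units of the standard deviation `1 / √(2γ)` of the
noise in each of them. -/
noncomputable def gain (γ : ℝ) (α : Fin B → ℝ) : Fin B ⊕ Fin B → ℝ :=
  Sum.elim (fun b => √(2 * γ) * α b) fun b => √(2 * γ) * α b

lemma measurable_complex_mk : Measurable fun p : ℝ × ℝ => (⟨p.1, p.2⟩ : ℂ) :=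
  Complex.measurableEquivRealProd.symm.measurable

lemma measurable_ofRealCoords (c : ℝ) : Measurable (ofRealCoords (B := B) c) := by
  refine measurable_pi_lambda _ fun b => measurable_complex_mk.comp
    (f := fun z : Fin B ⊕ Fin B → ℝ => (c * z (.inl b), c * z (.inr b))) (by fun_prop)

lemma measurable_realCoords : Measurable (realCoords (B := B)) := by
  refine measurable_pi_lambda _ fun j => ?_
  rcases j with b | b
  · exact Complex.measurable_re.comp (measurable_pi_apply b)
  · exact Complex.measurable_im.comp (measurable_pi_apply b)

lemma measurePreserving_complexNoise {γ : ℝ} (hγ : 0 < γ) :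
    MeasurePreserving (fun p : ℝ × ℝ => (⟨(√(2 * γ))⁻¹ * p.1, (√(2 * γ))⁻¹ * p.2⟩ : ℂ))
      ((gaussianReal 0 1).prod (gaussianReal 0 1)) (complexNoise γ) := by
  have h1 : MeasurePreserving (fun y => (√(2 * γ))⁻¹ * y) (gaussianReal 0 1)
      (gaussianReal 0 (1 / (2 * γ)).toNNReal) := by
    refine ⟨by fun_prop, ?_⟩
    rw [gaussianReal_map_const_mul]
    congr 1
    · simp
    · ext
      rw [Real.coe_toNNReal _ (by positivity)]
      change (√(2 * γ))⁻¹ ^ 2 * 1 = 1 / (2 * γ)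
      rw [inv_pow, Real.sq_sqrt (by positivity), mul_one, one_div]
  have h2 : MeasurePreserving (fun p : ℝ × ℝ => (⟨p.1, p.2⟩ : ℂ))
      ((gaussianReal 0 (1 / (2 * γ)).toNNReal).prod (gaussianReal 0 (1 / (2 * γ)).toNNReal))
      (complexNoise γ) := ⟨measurable_complex_mk, rfl⟩
  exact h2.comp (h1.prod h1)

instance (γ : ℝ) : IsProbabilityMeasure (complexNoise γ) :=
  Measure.isProbabilityMeasure_map measurable_complex_mk.aemeasurable

instance (γ : ℝ) : IsProbabilityMeasure (noise B γ) := by unfold noise; infer_instance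

/-- The noise vector is a rescaled standard Gaussian vector in `2B` real coordinates. -/
lemma measurePreserving_noise {γ : ℝ} (hγ : 0 < γ) :
    MeasurePreserving (ofRealCoords (B := B) (√(2 * γ))⁻¹) (stdGauss (Fin B ⊕ Fin B))
      (noise B γ) := by
  have h1 := measurePreserving_sumPiEquivProdPi (X := fun _ : Fin B ⊕ Fin B => ℝ)
    fun _ => gaussianReal 0 1
  have h2 := (measurePreserving_arrowProdEquivProdArrow ℝ ℝ (Fin B) (fun _ => gaussianReal 0 1)
    fun _ => gaussianReal 0 1).symm
  have h3 := measurePreserving_pi (fun _ : Fin B => (gaussianReal 0 1).prod (gaussianReal 0 1))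
    (fun _ => complexNoise γ) fun _ => measurePreserving_complexNoise hγ
  exact h3.comp (h2.comp h1)

lemma ofRealCoords_gain_mul {γ : ℝ} (hγ : 0 < γ) (α : Fin B → ℝ) (x : Fin B → ℂ) :
    ofRealCoords (√(2 * γ))⁻¹ (fun j => gain γ α j * realCoords x j) = fade α x := by
  have h : √(2 * γ) ≠ 0 := by positivity
  ext b
  simp only [ofRealCoords, gain, realCoords, fade, Sum.elim_inl, Sum.elim_inr]
  apply Complex.ext
  · simp; field_simp
  · simp; field_simp

/-- The density, relative to the law of the noise, of the channel output for the input `x`. -/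
noncomputable def channelLik (γ : ℝ) (α : Fin B → ℝ) (x y : Fin B → ℂ) : ℝ :=
  lik realCoords (gain γ α) (fun j => √(2 * γ) * realCoords y j) x

lemma channelLik_ofRealCoords {γ : ℝ} (hγ : 0 < γ) (α : Fin B → ℝ) (x : Fin B → ℂ)
    (z : Fin B ⊕ Fin B → ℝ) :
    channelLik γ α x (ofRealCoords (√(2 * γ))⁻¹ z) = lik realCoords (gain γ α) z x := by
  have h : √(2 * γ) ≠ 0 := by positivity
  unfold channelLik
  congr 1
  ext j
  rcases j with b | b <;> exact mul_inv_cancel_left₀ h _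

lemma measurable_channelLik (γ : ℝ) (α : Fin B → ℝ) :
    Measurable fun p : (Fin B → ℂ) × (Fin B → ℂ) => channelLik γ α p.1 p.2 := by
  have h1 : ∀ j, Measurable fun x : Fin B → ℂ => realCoords x j := fun j =>
    (measurable_pi_apply j).comp measurable_realCoords
  have h2 : ∀ j, Measurable fun p : (Fin B → ℂ) × (Fin B → ℂ) => realCoords p.1 j := fun j =>
    (h1 j).comp measurable_fst
  have h3 : ∀ j, Measurable fun p : (Fin B → ℂ) × (Fin B → ℂ) => realCoords p.2 j := fun j =>
    (h1 j).comp measurable_snd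
  unfold channelLik lik
  fun_prop

lemma measurable_channelLik_right (γ : ℝ) (α : Fin B → ℝ) (x : Fin B → ℂ) :
    Measurable fun y => channelLik γ α x y :=
  Measurable.comp (g := fun p : (Fin B → ℂ) × (Fin B → ℂ) => channelLik γ α p.1 p.2)
    (f := fun y => (x, y)) (measurable_channelLik γ α) measurable_prodMk_left

lemma ofRealCoords_add (c : ℝ) (a z : Fin B ⊕ Fin B → ℝ) :
    ofRealCoords c (a + z) = ofRealCoords c a + ofRealCoords c z := by
  ext b
  apply Complex.ext <;> simp [ofRealCoords, mul_add]

lemma stdGauss_map_add_eq_withDensity_lik {ι κ : Type*} [Fintype ι] (x : κ → ι → ℝ) (σ : ι → ℝ)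
    (k : κ) : (stdGauss ι).map (fun z => (fun j => σ j * x k j) + z) =
      (stdGauss ι).withDensity fun z => ENNReal.ofReal (lik x σ z k) :=
  stdGauss_map_add _

lemma integral_lik {ι κ : Type*} [Fintype ι] (x : κ → ι → ℝ) (σ : ι → ℝ) (k : κ) :
    ∫ z, lik x σ z k ∂stdGauss ι = 1 := by
  have h := congrArg (fun μ : Measure (ι → ℝ) => ∫ _, (1 : ℝ) ∂μ)
    (stdGauss_map_add_eq_withDensity_lik x σ k)
  rw [integral_withDensity_eq_integral_toReal_smul (measurable_lik x σ k).ennreal_ofReal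
    (ae_of_all _ fun _ => ENNReal.ofReal_lt_top), integral_map (by fun_prop) (by fun_prop)] at h
  simpa [ENNReal.toReal_ofReal (lik_pos x σ _ k).le] using h.symm

lemma noise_map_add {γ : ℝ} (hγ : 0 < γ) (α : Fin B → ℝ) (x : Fin B → ℂ) :
    (noise B γ).map (fun w => fade α x + w) =
      (noise B γ).withDensity fun y => ENNReal.ofReal (channelLik γ α x y) := by
  have hT := measurable_ofRealCoords (B := B) (√(2 * γ))⁻¹
  have hℓ := measurable_channelLik_right γ α x
  have h1 : (noise B γ).map (fun w => fade α x + w) =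
      ((stdGauss (Fin B ⊕ Fin B)).map fun z => (fun j => gain γ α j * realCoords x j) + z).map
        (ofRealCoords (√(2 * γ))⁻¹) := by
    rw [← (measurePreserving_noise hγ).map_eq, Measure.map_map (measurable_const_add _) hT,
      Measure.map_map hT (measurable_const_add _)]
    congr 1
    ext1 z
    simp only [Function.comp_apply, ofRealCoords_add, ofRealCoords_gain_mul hγ]
  rw [h1, stdGauss_map_add_eq_withDensity_lik realCoords]
  refine Measure.ext_of_lintegral _ fun f hf => ?_
  have hfT : Measurable fun z => f (ofRealCoords (√(2 * γ))⁻¹ z) := hf.comp hT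
  rw [lintegral_map hf hT, lintegral_withDensity_eq_lintegral_mul _
    (measurable_lik _ _ _).ennreal_ofReal hfT,
    lintegral_withDensity_eq_lintegral_mul _ hℓ.ennreal_ofReal hf,
    ← (measurePreserving_noise hγ).lintegral_comp (hℓ.ennreal_ofReal.mul hf)]
  refine lintegral_congr fun z => ?_
  simp only [Pi.mul_apply, channelLik_ofRealCoords hγ]

/-- The instantaneous mutual information of the block fading channel is an increasing affine
function of `info` at the gains `gain γ α`. -/
lemma instMutualInfo_eq {Ωz : Finset (Fin B → ℂ)} {P : Matrix (Fin B) (Fin B) ℝ}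
    (hF : (precoded P Ωz).Nonempty) {γ : ℝ} (hγ : 0 < γ) (α : Fin B → ℝ) :
    instMutualInfo Ωz P γ α =
      (info (fun k : precoded P Ωz => realCoords k.1) (gain γ α) / (precoded P Ωz).card +
        Real.log (precoded P Ωz).card) / Real.log 2 / B := by
  set F := precoded P Ωz with hFdef
  set X : F → Fin B ⊕ Fin B → ℝ := fun k => realCoords k.1 with hX
  set σ := gain γ α with hσ
  have hne : Nonempty F := hF.to_subtype
  have hM : (0 : ℝ) < F.card := by exact_mod_cast hF.card_pos
  have hb := exists_abs_le_const σ
  have hT := measurePreserving_noise (B := B) hγ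
  have hfade : Measurable (fade α) := by unfold fade; fun_prop
  have hℓx := measurable_channelLik_right γ α
  have hlik : ∀ x z, lik realCoords σ z x = lik (fun _ : Unit => realCoords x) σ z () :=
    fun x z => rfl
  have hsum : ∀ z, ∑ x ∈ F, lik realCoords σ z x = ∑ k, lik X σ z k := fun z =>
    (Finset.sum_coe_sort F fun x => lik realCoords σ z x).symm
  have hgpos := sum_lik_pos X σ
  -- the integrand in the real coordinates
  have hform : ∀ x z, lik realCoords σ z x *
      Real.log (lik realCoords σ z x / ((∑ x ∈ F, lik realCoords σ z x) / F.card)) =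
      sumLikLog (fun _ : Unit => realCoords x) σ z -
        lik realCoords σ z x * Real.log (∑ k, lik X σ z k) +
        Real.log F.card * lik realCoords σ z x := fun x z => by
    have h1 := lik_pos realCoords σ z x
    rw [hsum, Real.log_div h1.ne' (div_pos (hgpos z) hM).ne', Real.log_div (hgpos z).ne' hM.ne']
    simp only [sumLikLog, Finset.univ_unique, Finset.sum_singleton, PUnit.default_eq_unit, ← hlik]
    ring
  have hi1 : ∀ x : Fin B → ℂ, Integrable
      (fun z => sumLikLog (fun _ : Unit => realCoords x) σ z) (stdGauss (Fin B ⊕ Fin B)) := fun x =>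
    (expGrowth_sumLikLog (fun _ : Unit => realCoords x) hb).integrable rfl
  have hi2 : ∀ x : Fin B → ℂ, Integrable
      (fun z => lik realCoords σ z x * Real.log (∑ k, lik X σ z k)) (stdGauss (Fin B ⊕ Fin B)) := fun x =>
    ((expGrowth_lik (fun _ : Unit => realCoords x) hb ()).mul
      (expGrowth_log_sum_lik X hb)).integrable rfl
  have hi3 : ∀ x : Fin B → ℂ, Integrable
      (fun z => Real.log F.card * lik realCoords σ z x) (stdGauss (Fin B ⊕ Fin B)) := fun x =>
    ((expGrowth_lik (fun _ : Unit => realCoords x) hb ()).integrable rfl).const_mul _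
  have hi12 : ∀ x : Fin B → ℂ, Integrable (fun z => sumLikLog (fun _ : Unit => realCoords x) σ z -
      lik realCoords σ z x * Real.log (∑ k, lik X σ z k)) (stdGauss (Fin B ⊕ Fin B)) := fun x =>
    (hi1 x).sub (hi2 x)
  have hmeas : ∀ x, Measurable fun y => channelLik γ α x y * Real.log (channelLik γ α x y /
      ((∑ x ∈ F, channelLik γ α x y) / F.card)) := fun x => by
    have := hℓx x
    have h2 : Measurable fun y => ∑ x ∈ F, channelLik γ α x y :=
      Finset.measurable_sum _ fun x _ => hℓx x
    fun_prop
  rw [instMutualInfo, mutualInfo_uniformOn F hF (noise B γ) hfade (measurable_channelLik γ α)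
    (fun x y => lik_pos _ _ _ _) (noise_map_add hγ α)]
  · congr 2
    have hint : ∀ x, ∫ y, channelLik γ α x y * Real.log (channelLik γ α x y /
        ((∑ x ∈ F, channelLik γ α x y) / F.card)) ∂noise B γ =
        ∫ z, sumLikLog (fun _ : Unit => realCoords x) σ z ∂stdGauss (Fin B ⊕ Fin B) -
          ∫ z, lik realCoords σ z x * Real.log (∑ k, lik X σ z k) ∂stdGauss (Fin B ⊕ Fin B) +
          Real.log F.card := fun x => by
      rw [← hT.map_eq, integral_map hT.measurable.aemeasurable (hmeas x).aestronglyMeasurable]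
      simp only [channelLik_ofRealCoords hγ, ← hσ, hform]
      rw [integral_add (hi12 x) (hi3 x), integral_sub (hi1 x) (hi2 x),
        integral_const_mul, integral_lik, mul_one]
    simp only [hint]
    rw [Finset.sum_add_distrib, Finset.sum_sub_distrib, ← integral_finsetSum _ fun x _ => hi2 x,
      Finset.sum_const, nsmul_eq_mul, add_div, mul_div_cancel_left₀ _ hM.ne', info,
      ← Finset.sum_coe_sort F]
    congr 4 with z
    rw [← Finset.sum_mul, hsum, sumLikLog]
  · intro x
    rw [← hT.map_eq, integrable_map_measure (hmeas x).aestronglyMeasurable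
      hT.measurable.aemeasurable]
    refine ((hi12 x).add (hi3 x)).congr (ae_of_all _ fun z => ?_)
    simp only [Function.comp_apply, channelLik_ofRealCoords hγ, ← hσ, hform,
      Pi.add_apply]

end Channel

/-! ### Concave functions that are invariant under cyclic shifts -/

section Cyclic

variable {n : ℕ} {Φ : (Fin (n + 1) → ℝ) → ℝ}

lemma comp_shift_eq (hΦ : ∀ a, Φ (fun i => a (i + 1)) = Φ a) (a : Fin (n + 1) → ℝ)
    (k : Fin (n + 1)) : Φ (fun i => a (i + k)) = Φ a := by
  induction k using Fin.induction with
  | zero => simp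
  | succ k ih =>
    rw [← ih, ← hΦ fun i => a (i + k.castSucc)]
    congr 1
    ext i
    rw [← Fin.coeSucc_eq_succ, add_assoc, add_comm (1 : Fin (n + 1))]

/-- A concave function on the orthant that is invariant under cyclic shifts is minimal, on a
simplex `∑ aᵢ = S`, at every vertex. -/
lemma vertex_le_of_concaveOn (hc : ConcaveOn ℝ {a : Fin (n + 1) → ℝ | ∀ i, 0 ≤ a i} Φ)
    (hΦ : ∀ a, Φ (fun i => a (i + 1)) = Φ a) {a : Fin (n + 1) → ℝ} (ha : ∀ i, 0 ≤ a i)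
    (b : Fin (n + 1)) : Φ (Pi.single b (∑ i, a i)) ≤ Φ a := by
  set S := ∑ i, a i with hS
  have hS0 : 0 ≤ S := Finset.sum_nonneg fun i _ => ha i
  have hvert : ∀ c, Φ (Pi.single c S) = Φ (Pi.single b S) := fun c => by
    rw [← comp_shift_eq hΦ (Pi.single b S) (b - c)]
    congr 1
    ext i
    simp only [Pi.single_apply]
    congr 1
    exact propext ⟨fun h => by rw [h]; abel, fun h => by
      rw [← sub_eq_zero] at h ⊢; rw [← h]; abel⟩
  -- for `S = 0` there is no normalization by `S`, but the simplex is a single point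
  rcases hS0.eq_or_lt with h0 | hpos
  · have : a = Pi.single b S := by
      ext i
      have := (Finset.sum_eq_zero_iff_of_nonneg fun i _ => ha i).1 h0.symm i (Finset.mem_univ i)
      rw [this, ← h0]; simp
    rw [← this]
  · have hdec : ∑ c, (a c / S) • (Pi.single c S : Fin (n + 1) → ℝ) = a := by
      ext i
      simp [Finset.sum_apply, Pi.single_apply, hpos.ne']
    have h := hc.le_map_sum (t := Finset.univ) (w := fun c => a c / S)
      (p := fun c => (Pi.single c S : Fin (n + 1) → ℝ)) (fun c _ => div_nonneg (ha c) hS0)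
      (by rw [← Finset.sum_div, div_self hpos.ne']) fun c _ i => by
        rcases eq_or_ne i c with rfl | hic
        · simpa using hS0
        · simp [hic]
    rw [hdec] at h
    simp only [hvert, ← Finset.sum_smul, ← Finset.sum_div] at h
    rwa [← hS, div_self hpos.ne', one_smul] at h

/-- A concave function on the orthant that is invariant under cyclic shifts is maximal, on a
simplex `∑ aᵢ = S`, at the barycentre. -/
lemma le_barycentre_of_concaveOn (hc : ConcaveOn ℝ {a : Fin (n + 1) → ℝ | ∀ i, 0 ≤ a i} Φ)
    (hΦ : ∀ a, Φ (fun i => a (i + 1)) = Φ a) {a : Fin (n + 1) → ℝ} (ha : ∀ i, 0 ≤ a i) :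
    Φ a ≤ Φ fun _ => (∑ i, a i) / (n + 1 : ℕ) := by
  have hn : ((n + 1 : ℕ) : ℝ) ≠ 0 := by positivity
  have h := hc.le_map_sum (t := Finset.univ) (w := fun _ : Fin (n + 1) => ((n + 1 : ℕ) : ℝ)⁻¹)
    (p := fun k i => a (i + k)) (fun _ _ => by positivity) (by
      rw [Finset.sum_const, Finset.card_univ, Fintype.card_fin, nsmul_eq_mul, mul_inv_cancel₀ hn])
    fun k _ i => ha _
  have hmean : ∑ k : Fin (n + 1), ((n + 1 : ℕ) : ℝ)⁻¹ • (fun i => a (i + k)) =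
      fun _ => (∑ i, a i) / (n + 1 : ℕ) := by
    ext i
    rw [Finset.sum_apply, div_eq_inv_mul, Finset.mul_sum]
    exact Equiv.sum_comp (Equiv.addLeft i) fun k => ((n + 1 : ℕ) : ℝ)⁻¹ • a k
  rw [hmean] at h
  simpa only [comp_shift_eq hΦ, Finset.sum_const, Finset.card_univ, Fintype.card_fin, nsmul_eq_mul,
    smul_eq_mul, mul_inv_cancel_left₀ hn] using h

end Cyclic

/-! ### The symmetry of the precoded constellation -/

section Symmetry

lemma precode_injective {B : ℕ} {P : Matrix (Fin B) (Fin B) ℝ}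
    (hP : P ∈ Matrix.orthogonalGroup (Fin B) ℝ) : Function.Injective (precode P) := by
  have h1 : P.transpose * P = 1 :=
    (Matrix.mem_orthogonalGroup_iff' _ _).1 hP
  have h2 : (P.transpose.map Complex.ofRealHom) * (P.map Complex.ofRealHom) = 1 := by
    rw [← Matrix.map_mul, h1, Matrix.map_one _ (map_zero _) (map_one _)]
  have h3 : ∀ z, precode P z = (P.map Complex.ofRealHom).mulVec z := fun z => rfl
  intro z z' h
  rw [h3, h3] at h
  have := congrArg (P.transpose.map Complex.ofRealHom).mulVec h
  simpa [Matrix.mulVec_mulVec, h2] using this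

/-- The symmetry that both cases of `SymmetricPrecoding` share: up to signs, the precoded
constellation is invariant under the cyclic shift of the components. -/
lemma exists_sign_of_symmetricPrecoding {n : ℕ} {Ωz : Finset (Fin (n + 2) → ℂ)}
    {P : Matrix (Fin (n + 2)) (Fin (n + 2)) ℝ} (h : SymmetricPrecoding (n + 2) Ωz P) :
    P ∈ Matrix.orthogonalGroup (Fin (n + 2)) ℝ ∧ ∃ ε : Fin (n + 2) → ℝ, (∀ i, ε i = 1 ∨ ε i = -1) ∧
      ∀ x ∈ precoded P Ωz, (fun i => (ε i : ℂ) * x (i + 1)) ∈ precoded P Ωz := by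
  match n, Ωz, P, h with
  | 0, Ωz, P, h =>
    obtain ⟨hP, hΩ⟩ := h
    refine ⟨hP, ?_⟩
    have hrot : ∀ z ∈ Ωz, ![-z 1, z 0] ∈ Ωz := fun z hz => by
      have : ![-z 1, z 0] ∈ (fun z : Fin 2 → ℂ => ![-z 1, z 0]) '' (Ωz : Set (Fin 2 → ℂ)) :=
        ⟨z, hz, rfl⟩
      rw [hΩ] at this
      exact this
    have hPP : P.transpose * P = 1 := (Matrix.mem_orthogonalGroup_iff' _ _).1 hP
    have e00 := congrFun (congrFun hPP 0) 0
    have e01 := congrFun (congrFun hPP 0) 1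
    have e11 := congrFun (congrFun hPP 1) 1
    simp [Matrix.mul_apply, Fin.sum_univ_two] at e00 e01 e11
    -- the determinant is `1` (a rotation) or `-1` (a reflection)
    have hdet : (P 0 0 * P 1 1 - P 0 1 * P 1 0 - 1) * (P 0 0 * P 1 1 - P 0 1 * P 1 0 + 1) = 0 := by
      linear_combination e00 * (P 0 1 * P 0 1 + P 1 1 * P 1 1) + e11 -
        (P 0 0 * P 0 1 + P 1 0 * P 1 1) * e01
    rcases mul_eq_zero.1 hdet with hd | hd
    · have h11 : P 1 1 = P 0 0 := by
        linear_combination -P 1 1 * hd - P 0 1 * e01 + P 0 0 * e11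
      have h10 : P 1 0 = -P 0 1 := by
        linear_combination -P 1 0 * hd + P 0 0 * e01 - P 0 1 * e00
      refine ⟨![-1, 1], fun i => by fin_cases i <;> simp, fun x hx => ?_⟩
      obtain ⟨z, hz, rfl⟩ := Finset.mem_image.1 hx
      refine Finset.mem_image.2 ⟨_, hrot z hz, ?_⟩
      ext i
      fin_cases i <;> simp [precode, Fin.sum_univ_two, h11, h10]
      ring
    · have h11 : P 1 1 = -P 0 0 := by
        linear_combination P 1 1 * hd + P 0 1 * e01 - P 0 0 * e11
      have h10 : P 1 0 = P 0 1 := by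
        linear_combination P 1 0 * hd - P 0 0 * e01 + P 0 1 * e00
      refine ⟨![1, -1], fun i => by fin_cases i <;> simp, fun x hx => ?_⟩
      obtain ⟨z, hz, rfl⟩ := Finset.mem_image.1 hx
      refine Finset.mem_image.2 ⟨_, hrot z hz, ?_⟩
      ext i
      fin_cases i <;> simp [precode, Fin.sum_univ_two, h11, h10]
      ring
  | n + 1, Ωz, P, h =>
    obtain ⟨hP, ⟨v, rfl⟩, hΩ⟩ := h
    refine ⟨hP, fun _ => 1, fun _ => Or.inl rfl, fun x hx => ?_⟩
    obtain ⟨z, hz, rfl⟩ := Finset.mem_image.1 hx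
    have hz' : (fun i => z (i + 1)) ∈ Ωz := by
      have : (fun i => z (i + 1)) ∈ (fun (z : Fin (n + 3) → ℂ) (i : Fin (n + 3)) => z (i + 1)) ''
          (Ωz : Set (Fin (n + 3) → ℂ)) := ⟨z, hz, rfl⟩
      rw [hΩ] at this
      exact this
    refine Finset.mem_image.2 ⟨_, hz', ?_⟩
    ext i
    simp only [precode, Matrix.circulant_apply, Complex.ofReal_one, one_mul]
    conv_rhs => rw [← Equiv.sum_comp (Equiv.addRight (1 : Fin (n + 3)))]
    simp

end Symmetry

/-! ### Extremal points of the mutual information and of the minimum distance -/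

section Extremal

variable {n : ℕ}

/-- `info` for the constellation `F`, as a function of the squared gains of the complex channels.
The real and the imaginary part have the same gain. -/
noncomputable def infoSq {B : ℕ} (F : Finset (Fin B → ℂ)) (a : Fin B → ℝ) : ℝ :=
  info (fun k : F => realCoords k.1) fun j => √(Sum.elim a a j)

/-- The minimum distance of the faded constellation as a function of the squared gains. -/
noncomputable def distSq {B : ℕ} (F : Finset (Fin B → ℂ)) (a : Fin B → ℝ) : ℝ :=
  sInf {d | ∃ x ∈ F, ∃ x' ∈ F, x ≠ x' ∧ d = √(∑ b, a b * ‖x b - x' b‖ ^ 2)}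

lemma concaveOn_infoSq {B : ℕ} {F : Finset (Fin B → ℂ)} (hF : F.Nonempty) :
    ConcaveOn ℝ {a : Fin B → ℝ | ∀ i, 0 ≤ a i} (infoSq F) := by
  have : Nonempty F := hF.to_subtype
  have h := concaveOn_info fun k : F => realCoords k.1
  have hmem : ∀ a : Fin B → ℝ, (∀ i, 0 ≤ a i) → ∀ j, 0 ≤ Sum.elim a a j := fun a ha j => by
    rcases j with b | b <;> exact ha b
  refine ⟨fun a ha a' ha' s t hs ht _ i =>
    add_nonneg (mul_nonneg hs (ha i)) (mul_nonneg ht (ha' i)), fun a ha a' ha' s t hs ht hst => ?_⟩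
  have h1 := h.2 (hmem a ha) (hmem a' ha') hs ht hst
  have h2 : s • Sum.elim a a + t • Sum.elim a' a' = Sum.elim (s • a + t • a') (s • a + t • a') := by
    ext j
    rcases j with b | b <;> rfl
  rw [h2] at h1
  exact h1

lemma concaveOn_distSq {B : ℕ} {F : Finset (Fin B → ℂ)} (hF : 1 < F.card) :
    ConcaveOn ℝ {a : Fin B → ℝ | ∀ i, 0 ≤ a i} (distSq F) := by
  refine ⟨fun a ha a' ha' s t hs ht _ i =>
    add_nonneg (mul_nonneg hs (ha i)) (mul_nonneg ht (ha' i)), fun a ha a' ha' s t hs ht hst => ?_⟩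
  obtain ⟨y, hy, y', hy', hyy⟩ := Finset.one_lt_card.1 hF
  refine le_csInf ⟨_, y, hy, y', hy', hyy, rfl⟩ ?_
  rintro d ⟨x, hx, x', hx', hne, rfl⟩
  have hbdd : ∀ a : Fin B → ℝ, BddBelow
      {d | ∃ x ∈ F, ∃ x' ∈ F, x ≠ x' ∧ d = √(∑ b, a b * ‖x b - x' b‖ ^ 2)} := fun a =>
    ⟨0, by rintro d ⟨x, -, x', -, -, rfl⟩; exact Real.sqrt_nonneg _⟩
  have h1 : distSq F a ≤ √(∑ b, a b * ‖x b - x' b‖ ^ 2) :=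
    csInf_le (hbdd a) ⟨x, hx, x', hx', hne, rfl⟩
  have h2 : distSq F a' ≤ √(∑ b, a' b * ‖x b - x' b‖ ^ 2) :=
    csInf_le (hbdd a') ⟨x, hx, x', hx', hne, rfl⟩
  have hnn : ∀ a : Fin B → ℝ, (∀ i, 0 ≤ a i) → 0 ≤ ∑ b, a b * ‖x b - x' b‖ ^ 2 := fun a ha =>
    Finset.sum_nonneg fun b _ => mul_nonneg (ha b) (sq_nonneg _)
  have h3 := Real.strictConcaveOn_sqrt.concaveOn.2 (hnn a ha) (hnn a' ha') hs ht hst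
  have h4 : ∑ b, (s • a + t • a') b * ‖x b - x' b‖ ^ 2 =
      s • (∑ b, a b * ‖x b - x' b‖ ^ 2) + t • ∑ b, a' b * ‖x b - x' b‖ ^ 2 := by
    simp only [Pi.add_apply, Pi.smul_apply, smul_eq_mul, Finset.mul_sum,
      ← Finset.sum_add_distrib]
    exact Finset.sum_congr rfl fun b _ => by ring
  rw [h4]
  exact (add_le_add (mul_le_mul_of_nonneg_left h1 hs) (mul_le_mul_of_nonneg_left h2 ht)).trans h3

/-- A signed shift that maps a finite set into itself permutes this set. -/
lemma exists_perm_signedShift {F : Finset (Fin (n + 1) → ℂ)} {ε : Fin (n + 1) → ℝ}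
    (hε : ∀ i, ε i = 1 ∨ ε i = -1)
    (hF : ∀ x ∈ F, (fun i => (ε i : ℂ) * x (i + 1)) ∈ F) :
    ∃ τ : Equiv.Perm F, ∀ k i, (τ k).1 i = (ε i : ℂ) * k.1 (i + 1) := by
  have hinj : Function.Injective fun k : F =>
      (⟨fun i => (ε i : ℂ) * k.1 (i + 1), hF k.1 k.2⟩ : F) := by
    intro k l hkl
    ext i
    have := congrFun (congrArg Subtype.val hkl) (i - 1)
    simp only [sub_add_cancel] at this
    refine mul_left_cancel₀ ?_ this
    rcases hε (i - 1) with h | h <;> simp [h]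
  exact ⟨Equiv.ofBijective _ (Finite.injective_iff_bijective.1 hinj), fun k i => rfl⟩

lemma infoSq_shift {F : Finset (Fin (n + 1) → ℂ)} {ε : Fin (n + 1) → ℝ}
    (hε : ∀ i, ε i = 1 ∨ ε i = -1) (hF : ∀ x ∈ F, (fun i => (ε i : ℂ) * x (i + 1)) ∈ F)
    (a : Fin (n + 1) → ℝ) : infoSq F (fun i => a (i + 1)) = infoSq F a := by
  obtain ⟨τ, hτ⟩ := exists_perm_signedShift hε hF
  have h := info_comp_perm (fun k : F => realCoords k.1) (fun j => √(Sum.elim a a j))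
    (Equiv.sumCongr (Equiv.addRight (1 : Fin (n + 1))) (Equiv.addRight (1 : Fin (n + 1))))
    (ε := Sum.elim ε ε) (fun j => by rcases j with b | b <;> exact hε b) τ (fun k j => by
      rcases j with b | b <;> simp [realCoords, hτ])
  unfold infoSq
  rw [← h]
  congr 1
  ext j
  rcases j with b | b <;> rfl

lemma distSq_shift {F : Finset (Fin (n + 1) → ℂ)} {ε : Fin (n + 1) → ℝ}
    (hε : ∀ i, ε i = 1 ∨ ε i = -1) (hF : ∀ x ∈ F, (fun i => (ε i : ℂ) * x (i + 1)) ∈ F)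
    (a : Fin (n + 1) → ℝ) : distSq F (fun i => a (i + 1)) = distSq F a := by
  obtain ⟨τ, hτ⟩ := exists_perm_signedShift hε hF
  have hd : ∀ k l : F, ∑ b, a (b + 1) * ‖(τ k).1 b - (τ l).1 b‖ ^ 2 =
      ∑ b, a b * ‖k.1 b - l.1 b‖ ^ 2 := fun k l => by
    rw [← Equiv.sum_comp (Equiv.addRight (1 : Fin (n + 1))) fun b => a b * ‖k.1 b - l.1 b‖ ^ 2]
    refine Finset.sum_congr rfl fun b _ => ?_
    rw [hτ, hτ, ← mul_sub, norm_mul]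
    rcases hε b with h | h <;> simp [h]
  unfold distSq
  congr 1
  ext d
  constructor
  · rintro ⟨x, hx, x', hx', hne, rfl⟩
    refine ⟨_, (τ.symm ⟨x, hx⟩).2, _, (τ.symm ⟨x', hx'⟩).2, fun h => hne ?_, ?_⟩
    · simpa using τ.symm.injective (Subtype.ext h)
    · rw [← hd]; simp
  · rintro ⟨x, hx, x', hx', hne, rfl⟩
    refine ⟨_, (τ ⟨x, hx⟩).2, _, (τ ⟨x', hx'⟩).2, fun h => hne ?_, ?_⟩
    · simpa using τ.injective (Subtype.ext h)
    · rw [hd]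

lemma fadedMinDist_eq {B : ℕ} (Ωz : Finset (Fin B → ℂ)) (P : Matrix (Fin B) (Fin B) ℝ)
    (α : Fin B → ℝ) : fadedMinDist Ωz P α = distSq (precoded P Ωz) fun b => α b ^ 2 := by
  have h : ∀ x x' : Fin B → ℂ, ∑ b, ‖fade α x b - fade α x' b‖ ^ 2 =
      ∑ b, α b ^ 2 * ‖x b - x' b‖ ^ 2 := fun x x' =>
    Finset.sum_congr rfl fun b _ => by
      rw [fade, fade, ← mul_sub, norm_mul, mul_pow, Complex.norm_real, Real.norm_eq_abs, sq_abs]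
  simp only [fadedMinDist, distSq, h]

lemma gain_eq_sqrt {B : ℕ} {γ : ℝ} (hγ : 0 < γ) {α : Fin B → ℝ} (hα : ∀ b, 0 ≤ α b) :
    gain γ α = fun j => √(Sum.elim (fun b => 2 * γ * α b ^ 2) (fun b => 2 * γ * α b ^ 2) j) := by
  ext j
  rcases j with b | b <;>
    simp only [gain, Sum.elim_inl, Sum.elim_inr] <;>
    rw [Real.sqrt_mul (by positivity : 0 ≤ 2 * γ) (α b ^ 2), Real.sqrt_sq (hα b)]

lemma axisPoint_sq {B : ℕ} (b : Fin B) (c r : ℝ) :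
    (fun i => c * axisPoint b r i ^ 2) = Pi.single b (c * r ^ 2) := by
  ext i
  rcases eq_or_ne i b with rfl | h
  · simp [axisPoint]
  · simp [axisPoint, h]

lemma instMutualInfo_eq_infoSq {B : ℕ} {Ωz : Finset (Fin B → ℂ)} {P : Matrix (Fin B) (Fin B) ℝ}
    (hF : (precoded P Ωz).Nonempty) {γ : ℝ} (hγ : 0 < γ) {α : Fin B → ℝ} (hα : ∀ b, 0 ≤ α b) :
    instMutualInfo Ωz P γ α =
      (infoSq (precoded P Ωz) (fun b => 2 * γ * α b ^ 2) / (precoded P Ωz).card +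
        Real.log (precoded P Ωz).card) / Real.log 2 / B := by
  rw [instMutualInfo_eq hF hγ, gain_eq_sqrt hγ hα, infoSq]

lemma gain_smul {B : ℕ} (γ t : ℝ) (α : Fin B → ℝ) :
    gain γ (fun b => t * α b) = fun j => t * gain γ α j := by
  ext j
  rcases j with b | b <;> simp only [gain, Sum.elim_inl, Sum.elim_inr] <;> ring

variable {Ωz : Finset (Fin (n + 2) → ℂ)} {P : Matrix (Fin (n + 2)) (Fin (n + 2)) ℝ} {γ : ℝ}

/-- The affine function of `instMutualInfo_eq` is increasing. -/
lemma strictMono_affine {B : ℕ} (hB : 0 < B) (hF : (precoded P Ωz).Nonempty) :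
    StrictMono fun y : ℝ => (y / (precoded P Ωz).card +
        Real.log (precoded P Ωz).card) / Real.log 2 / B := by
  have h1 : (0 : ℝ) < (precoded P Ωz).card := by exact_mod_cast hF.card_pos
  have h2 : 0 < Real.log 2 := Real.log_pos one_lt_two
  have h3 : (0 : ℝ) < B := by exact_mod_cast hB
  intro y y' h
  simp only
  gcongr

/-- The mutual information is least on the axes, among the gains with the same sum of squares. -/
lemma instMutualInfo_axisPoint_le (hsym : SymmetricPrecoding (n + 2) Ωz P)
    (hF : (precoded P Ωz).Nonempty) (hγ : 0 < γ) {α : Fin (n + 2) → ℝ} (hα : ∀ b, 0 ≤ α b)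
    (b : Fin (n + 2)) :
    instMutualInfo Ωz P γ (axisPoint b √(∑ b, α b ^ 2)) ≤ instMutualInfo Ωz P γ α := by
  obtain ⟨-, ε, hε, hinv⟩ := exists_sign_of_symmetricPrecoding hsym
  have hax : ∀ c, 0 ≤ axisPoint b √(∑ b, α b ^ 2) c := fun c => by
    rcases eq_or_ne c b with rfl | h
    · simp [axisPoint]
    · simp [axisPoint, h]
  rw [instMutualInfo_eq_infoSq hF hγ hα, instMutualInfo_eq_infoSq hF hγ hax]
  refine (strictMono_affine (B := n + 2) (by omega) hF).monotone ?_
  rw [axisPoint_sq, Real.sq_sqrt (Finset.sum_nonneg fun _ _ => sq_nonneg _), Finset.mul_sum]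
  exact vertex_le_of_concaveOn (concaveOn_infoSq hF) (infoSq_shift hε hinv)
    (fun i => by positivity) b

/-- The mutual information is greatest on the ergodic line, among the gains with the same sum of
squares. -/
lemma instMutualInfo_le_ergodicPoint (hsym : SymmetricPrecoding (n + 2) Ωz P)
    (hF : (precoded P Ωz).Nonempty) (hγ : 0 < γ) {α : Fin (n + 2) → ℝ} (hα : ∀ b, 0 ≤ α b) :
    instMutualInfo Ωz P γ α ≤
      instMutualInfo Ωz P γ
        (ergodicPoint (n + 2) √((∑ b, α b ^ 2) / ((n + 2 : ℕ) : ℝ))) := by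
  obtain ⟨-, ε, hε, hinv⟩ := exists_sign_of_symmetricPrecoding hsym
  rw [instMutualInfo_eq_infoSq hF hγ hα,
    instMutualInfo_eq_infoSq hF hγ
      (α := ergodicPoint (n + 2) √((∑ b, α b ^ 2) / ((n + 2 : ℕ) : ℝ))) (fun b => Real.sqrt_nonneg _)]
  refine (strictMono_affine (B := n + 2) (by omega) hF).monotone ?_
  have h := le_barycentre_of_concaveOn (concaveOn_infoSq hF) (infoSq_shift hε hinv)
    (a := fun b => 2 * γ * α b ^ 2) (fun i => by positivity)
  have e : (fun b => 2 * γ * ergodicPoint (n + 2) √((∑ b, α b ^ 2) / ((n + 2 : ℕ) : ℝ)) b ^ 2) =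
      fun _ : Fin (n + 2) => (∑ b, 2 * γ * α b ^ 2) / ((n + 2 : ℕ) : ℝ) := by
    ext b
    change 2 * γ * √((∑ b, α b ^ 2) / ((n + 2 : ℕ) : ℝ)) ^ 2 = _
    rw [Real.sq_sqrt (div_nonneg (Finset.sum_nonneg fun _ _ => sq_nonneg _)
      (Nat.cast_nonneg _)), ← Finset.mul_sum, mul_div_assoc]
  rw [e]
  exact h

lemma instMutualInfo_axisPoint_mono (hF : (precoded P Ωz).Nonempty) (hγ : 0 < γ)
    (b : Fin (n + 2)) :
    MonotoneOn (fun r => instMutualInfo Ωz P γ (axisPoint b r)) (Set.Ici 0) := by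
  have : Nonempty (precoded P Ωz) := hF.to_subtype
  have h : ∀ r, axisPoint b r = fun c => r * axisPoint b 1 c := fun r => by
    ext c
    rcases eq_or_ne c b with rfl | h
    · simp [axisPoint]
    · simp [axisPoint, h]
  simp only [instMutualInfo_eq hF hγ]
  refine (strictMono_affine (B := n + 2) (by omega) hF).monotone.comp_monotoneOn ?_
  have hm := monotoneOn_info_ray (fun k : precoded P Ωz => realCoords k.1)
    (gain γ (axisPoint b 1))
  intro r hr r' hr' hrr
  change info _ (gain γ (axisPoint b r)) ≤ info _ (gain γ (axisPoint b r'))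
  rw [h r, h r', gain_smul, gain_smul]
  exact hm hr hr' hrr

lemma instMutualInfo_ergodicPoint_strictMono (hF : 1 < (precoded P Ωz).card) (hγ : 0 < γ) :
    StrictMonoOn (fun r => instMutualInfo Ωz P γ (ergodicPoint (n + 2) r)) (Set.Ici 0) := by
  have hF' : (precoded P Ωz).Nonempty := Finset.card_pos.1 (by omega)
  obtain ⟨x, hx, x', hx', hne⟩ := Finset.one_lt_card.1 hF
  obtain ⟨j, hj⟩ : ∃ j, realCoords x j ≠ realCoords x' j := by
    by_contra! h
    refine hne (funext fun b => Complex.ext (h (.inl b)) (h (.inr b)))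
  have h : ∀ r, ergodicPoint (n + 2) r = fun c => r * ergodicPoint (n + 2) 1 c := fun r => by
    ext c; simp [ergodicPoint]
  simp only [instMutualInfo_eq hF' hγ]
  refine (strictMono_affine (B := n + 2) (by omega) hF').comp_strictMonoOn ?_
  have hγ' : √(2 * γ) ≠ 0 := by positivity
  have hm := strictMonoOn_info_ray (fun k : precoded P Ωz => realCoords k.1)
    (σ := gain γ (ergodicPoint (n + 2) 1)) (j := j) (k := ⟨x, hx⟩) (l := ⟨x', hx'⟩)
    (by rcases j with b | b <;> simpa [gain, ergodicPoint] using hγ') hj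
  intro r hr r' hr' hrr
  change info _ (gain γ (ergodicPoint (n + 2) r)) < info _ (gain γ (ergodicPoint (n + 2) r'))
  rw [h r, h r', gain_smul, gain_smul]
  exact hm hr hr' hrr

end Extremal

end BlockFading

theorem proposition5 (B m : ℕ) (hm : 1 ≤ m) (Ωz : Finset (Fin B → ℂ)) (hcard : Ωz.card = 2 ^ m)
    (P : Matrix (Fin B) (Fin B) ℝ) (hsym : BlockFading.SymmetricPrecoding B Ωz P) :
    (∃ ρ₀ : ℝ, ∀ γ R : ℝ, 0 < γ →
      -- outer bound
      (∀ (b : Fin B) (αo : ℝ), BlockFading.IsAxisMagnitude Ωz P γ R b αo →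
        ρ₀ ≤ BlockFading.instSNR γ (BlockFading.axisPoint b αo) →
        BlockFading.outageRegion Ωz P γ R ⊆ BlockFading.sphereRegion B (αo ^ 2)) ∧
      -- inner bound
      (∀ αe : ℝ, BlockFading.IsErgodicMagnitude Ωz P γ R αe →
        ρ₀ ≤ BlockFading.instSNR γ (BlockFading.ergodicPoint B αe) →
        BlockFading.sphereRegion B (B * αe ^ 2) ⊆ BlockFading.outageRegion Ωz P γ R)) ∧
    -- extremal minimum distance of the faded constellation on every sphere
    (∀ (r : ℝ) (α : Fin B → ℝ), 0 ≤ r → (∀ b, 0 ≤ α b) → ∑ b, α b ^ 2 = r ^ 2 →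
      (∀ b : Fin B, BlockFading.fadedMinDist Ωz P (BlockFading.axisPoint b r) ≤
        BlockFading.fadedMinDist Ωz P α) ∧
      BlockFading.fadedMinDist Ωz P α ≤
        BlockFading.fadedMinDist Ωz P (BlockFading.ergodicPoint B (r / √B))) := by
  open BlockFading in
  match B, Ωz, P, hsym, hcard with
  | 0, _, _, h, _ => exact h.elim
  | 1, _, _, h, _ => exact h.elim
  | n + 2, Ωz, P, hsym, hcard =>
  obtain ⟨hP, ε, hε, hinv⟩ := exists_sign_of_symmetricPrecoding hsym
  have hF : 1 < (precoded P Ωz).card := by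
    rw [precoded, Finset.card_image_of_injective _ (precode_injective hP), hcard]
    exact Nat.one_lt_two_pow (by omega)
  have hF' : (precoded P Ωz).Nonempty := Finset.card_pos.1 (by omega)
  have hB : (0 : ℝ) < (n + 2 : ℕ) := by positivity
  refine ⟨⟨0, fun γ R hγ => ⟨fun b αo hαo _ α hα => ⟨hα.1, ?_⟩,
    fun αe hαe _ α hα => ⟨hα.1, ?_⟩⟩⟩, fun r α hr hα hsum => ⟨fun b => ?_, ?_⟩⟩
  · by_contra! hle
    have h1 := instMutualInfo_axisPoint_le hsym hF' hγ hα.1 b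
    have h2 := instMutualInfo_axisPoint_mono hF' hγ b hαo.1 (Real.sqrt_nonneg _)
      (Real.le_sqrt_of_sq_le hle)
    have h3 := hαo.2
    have h4 := hα.2
    simp only at h2
    linarith
  · have h1 := instMutualInfo_le_ergodicPoint hsym hF' hγ hα.1
    have h2 := instMutualInfo_ergodicPoint_strictMono hF hγ (Real.sqrt_nonneg _) hαe.1
      ((Real.sqrt_lt' (lt_of_le_of_ne hαe.1 fun h0 => ?_)).2
        ((div_lt_iff₀ hB).2 (by rw [mul_comm]; exact hα.2)))
    · exact h1.trans_lt (h2.trans_eq hαe.2)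
    · -- for `αe = 0` the open ball is empty
      have := hα.2
      rw [← h0] at this
      have h5 : 0 ≤ ∑ b, α b ^ 2 := Finset.sum_nonneg fun _ _ => sq_nonneg _
      norm_num at this
      linarith
  · rw [fadedMinDist_eq, fadedMinDist_eq]
    have h := vertex_le_of_concaveOn (concaveOn_distSq hF) (distSq_shift hε hinv)
      (a := fun b => α b ^ 2) (fun i => sq_nonneg _) b
    rw [hsum] at h
    have h6 := axisPoint_sq b 1 r
    simp only [one_mul] at h6
    rwa [h6]
  · rw [fadedMinDist_eq, fadedMinDist_eq]
    have h := le_barycentre_of_concaveOn (concaveOn_distSq hF) (distSq_shift hε hinv)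
      (a := fun b => α b ^ 2) (fun i => sq_nonneg _)
    rw [hsum] at h
    simpa only [ergodicPoint, div_pow, Real.sq_sqrt hB.le] using h
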